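/- **Setting.** Let $\mathbb T=[-\infty,\infty)$ and $\mathbb T^N=[-\infty,\infty)^N$. A *convex polyhedral domain* in $\mathbb T^N$ is the closure of a nonempty polyhedron $\{x\in\mathbb R^N: j_kx\le a_k\}$ (finitely many $j_k\in\mathbb Z^N$, $a_k\in\mathbb R$). A *polyhedral complex* $Y\subset\mathbb T^N$ of dimension $n$ is a finite union of $n$-dimensional convex polyhedral domains (facets) such that any nonempty intersection of facets is a face of each of them; it is *balanced* if at every codimension-one face $E$ the outward primitive integer vectors of the facets containing $E$ sum to $0$ modulo the span of $E$, and *regular at infinity* if every face $E$ meets each stratum $\mathbb T^\circ_I$ (coordinates in $I$ equal to $-\infty$, the others finite) in the empty set or in a polyhedron of dimension $\dim E-|I|$. A *tropical space* is a topological space $X$ with finitely many charts, i.e. open embeddings $\phi_i:W_i\to Y_i\subset\mathbb T^{N_i}$ of open sets $W_i$ covering $X$ into balanced polyhedral complexes regular at infinity, such that the overlapping maps are locally induced by (partially defined) integral affine maps $\mathbb T^{N_i}\dashrightarrow\mathbb T^{N_j}$, and such that the following finite type condition holds: if $x_k\in W_i$ and $\phi_i(x_k)\to y\in\mathbb T^{N_i}$,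 then either $(x_k)$ converges in $X$ or some coordinate is $-\infty$ at $y$ but finite on all of $\phi_i(W_i)$. For a point $y\in Y$ in the relative interior of a face $E\cap\{x : x_i=-\infty,\ i\in I\}$, with $E$ a face not contained in $\mathbb T^N\setminus\mathbb R^N$, the *wave tangent space* $W(y)\subset\mathbb R^N$ is the intersection of all maximal linear subspaces contained in the cone $\{u\in\mathbb R^N: p+tu\in Y\text{ for all small }t>0\}$, where $p$ is any finite point in the relative interior of $E$. The sheaf $\mathcal W_1$ on $X$ has as sections the families of locally constant vectors in the charts that lie in the wave tangent space at every point and are matched by the differentials of the overlapping maps. **The deformation.** Let $X$ be a compact Hausdorff tropical space and $\tau\in H^1(X;\mathcal W_1)$ (Čech cohomology). Choose a Čech cocycle $\tau_{\alpha\beta}\in\mathcal W_1(V_\alpha\cap V_\beta)$ representing $\tau$ on a finite open cover $\{V_\alpha\}$ such that each $V_\alpha$ lies in the domain of a chart, with restriction $\phi_\alpha:V_\alpha\to Y_\alpha\subset\mathbb T^{N_\alpha}$, and the vectors $\tau_{\alpha\beta}$, written in $\phi_\alpha$, are bounded (they are constant if $V_\alpha\cap V_\beta$ is connected). Choose also an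 open cover $\{U_\alpha\}$ of $X$ with $\overline{U_\alpha}\subset V_\alpha$. Let $\psi_{\alpha\beta}=\phi_\beta\circ\phi_\alpha^{-1}$ on $\phi_\alpha(V_\alpha\cap V_\beta)$. For $\varepsilon>0$ let $X_{\varepsilon\tau}$ be the quotient of $\bigsqcup_\alpha U_\alpha$ by the relation identifying $x\in U_\alpha$ with $y\in U_\beta$ when $\psi_{\alpha\beta}(\phi_\alpha(x)+\varepsilon\tau_{\alpha\beta})=\phi_\beta(y)$, i.e. when there is $z\in V_\alpha\cap V_\beta$ with $\phi_\alpha(x)+\varepsilon\tau_{\alpha\beta}(z)=\phi_\alpha(z)$ and $\phi_\beta(z)=\phi_\beta(y)$. **Proposition.** Every class $\tau\in H^1(X;\mathcal W_1)$ admits such choices of $\{V_\alpha\}$, $(\tau_{\alpha\beta})$, $\{U_\alpha\}$. For any such choices there is $\varepsilon_0>0$ such that for all $0<\varepsilon<\varepsilon_0$ the relation above is an equivalence relation, the quotient $X_{\varepsilon\tau}$ is Hausdorff, the natural maps $U_\alpha\to X_{\varepsilon\tau}$ are open embeddings, and $X_{\varepsilon\tau}$ is a tropical space, regular at infinity, with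 the maps $\phi_\alpha|_{U_\alpha}:U_\alpha\to Y_\alpha$ as charts. -/

import Mathlib

open Set Filter Topology

universe u

namespace Tropical

noncomputable section

/-! ## Tropical affine space -/

/-- The tropical numbers `[-∞, ∞)`, with the subspace topology of the extended reals. -/
abbrev TropNum : Type := {x : EReal // x ≠ ⊤}

/-- A real number as a tropical number. -/
def ofReal (r : ℝ) : TropNum := ⟨(r : EReal), EReal.coe_ne_top r⟩

/-- The tropical number `-∞`. -/
def negInf : TropNum := ⟨⊥, bot_ne_top⟩

/-- Tropical affine space `𝕋^N = [-∞, ∞)^N`, with the product topology. -/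
abbrev TropSpace (N : ℕ) : Type := Fin N → TropNum

/-- The inclusion `ℝ^N ⊆ 𝕋^N`. -/
def toTrop {N : ℕ} (x : Fin N → ℝ) : TropSpace N := fun i => ofReal (x i)

/-- The stratum `𝕋°_I` (coordinates in `I` are `-∞`, the others finite),
parametrized by `ℝ^{N - |I|}`. -/
def stratumEmb {N : ℕ} (I : Finset (Fin N)) (x : {i : Fin N // i ∉ I} → ℝ) : TropSpace N :=
  fun i => if h : i ∈ I then negInf else ofReal (x ⟨i, h⟩)

/-- Translation of `𝕋^N` by a real vector (with `-∞ + r = -∞`). -/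
def translate {N : ℕ} (v : Fin N → ℝ) (x : TropSpace N) : TropSpace N :=
  fun i => ⟨(x i : EReal) + ((v i : ℝ) : EReal), EReal.add_ne_top (x i).2 (EReal.coe_ne_top _)⟩

/-- The data of an integral affine map `ℝ^N → ℝ^M`: an integral linear part and a real
translation part. -/
structure IntAffine (N M : ℕ) where
  lin : Matrix (Fin M) (Fin N) ℤ
  const : Fin M → ℝ

namespace IntAffine

variable {N M : ℕ}

/-- The points of `𝕋^N` to which the integral affine map extends continuously with values
in `𝕋^M`: no infinite coordinate enters with a negative coefficient. -/
def DefinedAt (h : IntAffine N M) (x : TropSpace N) : Prop :=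
  ∀ i j, x j = negInf → 0 ≤ h.lin i j

open Classical in
/-- The value of the partially defined map `𝕋^N ⇢ 𝕋^M` (meaningful where it is defined). -/
def eval (h : IntAffine N M) (x : TropSpace N) : TropSpace M := fun i =>
  if ∃ j, x j = negInf ∧ h.lin i j ≠ 0 then negInf
  else ofReal (∑ j, (h.lin i j : ℝ) * (x j : EReal).toReal + h.const i)

/-- The linear part over the reals, i.e. the differential. -/
def differential (h : IntAffine N M) (w : Fin N → ℝ) : Fin M → ℝ :=
  fun i => ∑ j, (h.lin i j : ℝ) * w j

end IntAffine

/-! ## Polyhedral domains and complexes -/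

/-- The polyhedron in `ℝ^ι` cut out by finitely many inequalities `j x ≤ a` with integral `j`
and real `a`. -/
def ratPolyhedron {ι : Type} [Fintype ι] (H : Finset ((ι → ℤ) × ℝ)) : Set (ι → ℝ) :=
  {x | ∀ h ∈ H, ∑ i, (h.1 i : ℝ) * x i ≤ h.2}

/-- The subset of `ratPolyhedron H` where the inequalities in `S` are equalities. -/
def ratFace {ι : Type} [Fintype ι] (H S : Finset ((ι → ℤ) × ℝ)) : Set (ι → ℝ) :=
  {x | x ∈ ratPolyhedron H ∧ ∀ h ∈ S, ∑ i, (h.1 i : ℝ) * x i = h.2}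

/-- A convex polyhedral domain in `𝕋^N`: the closure in `𝕋^N` of a nonempty polyhedron in `ℝ^N`
given by finitely many inequalities with integral linear parts. -/
def IsPolyhedralDomain {N : ℕ} (D : Set (TropSpace N)) : Prop :=
  ∃ H : Finset ((Fin N → ℤ) × ℝ),
    (ratPolyhedron H).Nonempty ∧ D = closure (toTrop '' ratPolyhedron H)

/-- `E` is a mobile face of the convex polyhedral domain `D`. -/
def IsMobileFaceOf {N : ℕ} (E D : Set (TropSpace N)) : Prop :=
  ∃ H S : Finset ((Fin N → ℤ) × ℝ), S ⊆ H ∧ (ratFace H S).Nonempty ∧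
    D = closure (toTrop '' ratPolyhedron H) ∧ E = closure (toTrop '' ratFace H S)

/-- The non-infinite part `D ∩ ℝ^N`. -/
def mobilePart {N : ℕ} (D : Set (TropSpace N)) : Set (Fin N → ℝ) := toTrop ⁻¹' D

/-- The dimension of (the non-infinite part of) a convex polyhedral domain. -/
def mobileDim {N : ℕ} (D : Set (TropSpace N)) : ℕ :=
  Module.finrank ℝ (vectorSpan ℝ (mobilePart D))

/-- Regularity at infinity of a domain: for every `I`, the intersection with `𝕋°_I` is empty or
a polyhedral domain of dimension `dim D - |I|` in `𝕋°_I ≅ ℝ^{N - |I|}`. -/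
def IsRegularDomain {N : ℕ} (D : Set (TropSpace N)) : Prop :=
  ∀ I : Finset (Fin N), stratumEmb I ⁻¹' D = ∅ ∨
    ((∃ H, stratumEmb I ⁻¹' D = ratPolyhedron H) ∧
      Module.finrank ℝ (vectorSpan ℝ (stratumEmb I ⁻¹' D)) + I.card = mobileDim D)

/-- A polyhedral complex of pure dimension `dim` in `𝕋^N`, given by its facets. -/
structure PolyhedralComplex (N : ℕ) where
  dim : ℕ
  facets : Finset (Set (TropSpace N))
  isDomain : ∀ D ∈ facets, IsPolyhedralDomain D
  dim_facet : ∀ D ∈ facets, mobileDim D = dim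
  inter_face : ∀ S ⊆ facets, ∀ D ∈ S,
    ⋂₀ (S : Set (Set (TropSpace N))) = ∅ ∨ IsMobileFaceOf (⋂₀ (S : Set (Set (TropSpace N)))) D

namespace PolyhedralComplex

variable {N : ℕ} (Y : PolyhedralComplex N)

/-- The underlying set, the union of the facets. -/
def support : Set (TropSpace N) := ⋃₀ (Y.facets : Set (Set (TropSpace N)))

/-- Mobile faces of the complex: the mobile faces of its facets. -/
def IsMobileFace (E : Set (TropSpace N)) : Prop := ∃ D ∈ Y.facets, IsMobileFaceOf E D

/-- All mobile faces of the complex are regular at infinity. -/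
def IsRegular : Prop := ∀ E, Y.IsMobileFace E → IsRegularDomain E

end PolyhedralComplex

/-- For a codimension one face `E` of `D`: the integer vector `v` represents the outward
primitive integer vector of `D` in the quotient of `ℝ^N` by the linear span of `E`.
It points from `E` into `D`, and its class in the quotient lattice is not a proper multiple. -/
def IsOutwardPrimitive {N : ℕ} (E D : Set (TropSpace N)) (v : Fin N → ℤ) : Prop :=
  (∃ p ∈ mobilePart E, ∃ t : ℝ, 0 < t ∧ (p + t • fun i => (v i : ℝ)) ∈ mobilePart D) ∧
  ∀ (m : ℤ) (w : Fin N → ℤ),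
    (fun i => ((v i - m * w i : ℤ) : ℝ)) ∈ vectorSpan ℝ (mobilePart E) → IsUnit m

open Classical in
/-- The balancing condition at all mobile faces of codimension one. -/
def PolyhedralComplex.IsBalanced {N : ℕ} (Y : PolyhedralComplex N) : Prop :=
  ∀ E, Y.IsMobileFace E → mobileDim E + 1 = Y.dim →
    ∃ v : Set (TropSpace N) → Fin N → ℤ,
      (∀ D ∈ Y.facets, E ⊆ D → IsOutwardPrimitive E D (v D)) ∧
      (∑ D ∈ Y.facets with E ⊆ D, fun i => (v D i : ℝ)) ∈ vectorSpan ℝ (mobilePart E)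

/-! ## The wave tangent space -/

namespace PolyhedralComplex

variable {N : ℕ} (Y : PolyhedralComplex N)

/-- The cone `Σ(p)` at a mobile point `p`: vectors `w` with `p + t w ∈ Y` for small `t > 0`. -/
def tangentCone (p : Fin N → ℝ) : Set (Fin N → ℝ) :=
  {w | ∀ᶠ t : ℝ in 𝓝[>] 0, toTrop (p + t • w) ∈ Y.support}

/-- `W'(p)`: the intersection of all maximal linear subspaces contained in `Σ(p)`. -/
def mobileWave (p : Fin N → ℝ) : Submodule ℝ (Fin N → ℝ) :=
  sInf {L | Maximal (fun L : Submodule ℝ (Fin N → ℝ) => (L : Set (Fin N → ℝ)) ⊆ Y.tangentCone p) L}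

/-- `p` is a nearby mobile point to `y`: `y` lies in the relative interior of a (possibly
sedentary) face `E ∩ 𝕋_I` and `p` in the relative interior of its parent, the mobile face `E`. -/
def IsNearbyMobile (y : TropSpace N) (p : Fin N → ℝ) : Prop :=
  ∃ E, Y.IsMobileFace E ∧
    (∃ (I : Finset (Fin N)) (x : {i : Fin N // i ∉ I} → ℝ),
      stratumEmb I x = y ∧ x ∈ intrinsicInterior ℝ (stratumEmb I ⁻¹' E)) ∧
    p ∈ intrinsicInterior ℝ (mobilePart E)

/-- The wave tangent space `W(y)`, which is `W'(p)` for a nearby mobile point `p`.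
(It does not depend on `p`; the intersection avoids a choice.) -/
def wave (y : TropSpace N) : Submodule ℝ (Fin N → ℝ) :=
  ⨅ (p : Fin N → ℝ) (_ : Y.IsNearbyMobile y p), Y.mobileWave p

end PolyhedralComplex

/-! ## Tropical spaces -/

/-- The structure of a tropical space (regular at infinity) on `X`, with charts
`dom i → Y i ⊆ 𝕋^(N i)`. -/
structure TropicalAtlas (X : Type u) [TopologicalSpace X] {ι : Type*} (N : ι → ℕ)
    (Y : ∀ i, PolyhedralComplex (N i)) where
  balanced : ∀ i, (Y i).IsBalanced
  regular : ∀ i, (Y i).IsRegular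
  dom : ι → Set X
  chart : ∀ i, dom i → (Y i).support
  isOpen_dom : ∀ i, IsOpen (dom i)
  cover : ⋃ i, dom i = univ
  isOpenEmbedding_chart : ∀ i, IsOpenEmbedding (chart i)
  /-- Near each point, the overlapping maps are induced by integral affine maps. -/
  compatible : ∀ i j, ∀ x ∈ dom i ∩ dom j, ∃ h : IntAffine (N i) (N j),
    ∀ᶠ z in 𝓝 x, ∀ (hi : z ∈ dom i) (hj : z ∈ dom j),
      h.DefinedAt (chart i ⟨z, hi⟩ : TropSpace (N i)) ∧
        h.eval (chart i ⟨z, hi⟩ : TropSpace (N i)) = chart j ⟨z, hj⟩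
  /-- Finite type: there are finitely many charts, and … -/
  finite_charts : Finite ι
  /-- … a sequence whose image in a chart converges in `𝕋^(N i)` converges in `X`, unless the limit
  has an infinite coordinate that is finite on the whole chart. -/
  finite_type : ∀ (i : ι) (s : ℕ → dom i) (y : TropSpace (N i)),
    Tendsto (fun n => (chart i (s n) : TropSpace (N i))) atTop (𝓝 y) →
      (∃ x : X, Tendsto (fun n => (s n : X)) atTop (𝓝 x)) ∨
      ∃ k, y k = negInf ∧ ∀ z : dom i, (chart i z : TropSpace (N i)) k ≠ negInf

variable {X : Type u} [TopologicalSpace X] {ι : Type*} {N : ι → ℕ}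
  {Y : ∀ i, PolyhedralComplex (N i)}

/-- The integral affine map `h` induces the overlapping map from chart `i` to chart `j`
near `x`. -/
def TropicalAtlas.IsOverlapMap (T : TropicalAtlas X N Y) (i j : ι) (x : X)
    (h : IntAffine (N i) (N j)) : Prop :=
  ∀ᶠ z in 𝓝 x, ∀ (hi : z ∈ T.dom i) (hj : z ∈ T.dom j),
    h.DefinedAt (T.chart i ⟨z, hi⟩ : TropSpace (N i)) ∧
      h.eval (T.chart i ⟨z, hi⟩ : TropSpace (N i)) = T.chart j ⟨z, hj⟩

/-! ## The sheaf `𝒲₁` and its first cohomology -/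

/-- A section of the wave sheaf `𝒲₁` over `O`: in each chart a locally constant vector lying in
the wave tangent space at every point, the values in different charts being identified by the
differentials of the overlapping maps. -/
@[ext]
structure WaveSection (T : TropicalAtlas X N Y) (O : Set X) where
  val : ∀ i, ↥(O ∩ T.dom i) → Fin (N i) → ℝ
  mem_wave : ∀ i (x : ↥(O ∩ T.dom i)),
    val i x ∈ (Y i).wave (T.chart i ⟨x, x.2.2⟩ : TropSpace (N i))
  locallyConstant : ∀ i, IsLocallyConstant (val i)
  differential_eq : ∀ i j (x : X) (hO : x ∈ O) (hi : x ∈ T.dom i) (hj : x ∈ T.dom j)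
    (h : IntAffine (N i) (N j)), T.IsOverlapMap i j x h →
      h.differential (val i ⟨x, hO, hi⟩) = val j ⟨x, hO, hj⟩

/-- A Čech 1-cocycle with coefficients in `𝒲₁` on an open cover of `X`. -/
structure WaveCocycle (T : TropicalAtlas X N Y) where
  A : Type u
  V : A → Set X
  isOpen_V : ∀ α, IsOpen (V α)
  cover : ⋃ α, V α = univ
  sec : ∀ α β, WaveSection T (V α ∩ V β)
  cocycle : ∀ α β γ (i : ι) (x : X) (hα : x ∈ V α) (hβ : x ∈ V β) (hγ : x ∈ V γ)
    (hi : x ∈ T.dom i),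
    (sec α γ).val i ⟨x, ⟨hα, hγ⟩, hi⟩ =
      (sec α β).val i ⟨x, ⟨hα, hβ⟩, hi⟩ + (sec β γ).val i ⟨x, ⟨hβ, hγ⟩, hi⟩

/-- Two Čech cocycles define the same class if they differ by the coboundary of a 0-cochain
`(σ_c)` on a common refinement `(O_c)` of their covers. -/
def WaveCocycle.Cohomologous {T : TropicalAtlas X N Y} (c c' : WaveCocycle T) : Prop :=
  ∃ (C : Type u) (O : C → Set X) (r : C → c.A) (r' : C → c'.A)
    (σ : ∀ k, WaveSection T (O k)) (hr : ∀ k, O k ⊆ c.V (r k)) (hr' : ∀ k, O k ⊆ c'.V (r' k)),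
    (∀ k, IsOpen (O k)) ∧ ⋃ k, O k = univ ∧
    ∀ (k l : C) (i : ι) (x : X) (hk : x ∈ O k) (hl : x ∈ O l) (hi : x ∈ T.dom i),
      (c.sec (r k) (r l)).val i ⟨x, ⟨hr k hk, hr l hl⟩, hi⟩ -
        (c'.sec (r' k) (r' l)).val i ⟨x, ⟨hr' k hk, hr' l hl⟩, hi⟩ =
      (σ l).val i ⟨x, hl, hi⟩ - (σ k).val i ⟨x, hk, hi⟩

/-- The (Čech) cohomology `H¹(X; 𝒲₁)`, as a set. -/
def WaveH1 (T : TropicalAtlas X N Y) : Type _ := Quot (WaveCocycle.Cohomologous (T := T))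

/-- The class of a Čech 1-cocycle in `H¹(X; 𝒲₁)`. -/
def WaveCocycle.toH1 {T : TropicalAtlas X N Y} (c : WaveCocycle T) : WaveH1 T := Quot.mk _ c

/-! ## The deformation -/

/-- The choices made to deform `X` along a cocycle `τ_{αβ} = c.sec α β` on a cover `(V_α)`: the
cover is finite, each `V_α` is contained in a chart, the `U_α` form a slightly smaller open
cover, and the vectors `τ_{αβ}` are bounded in the chart (they are constant vectors if
`V_α ∩ V_β` is connected). -/
structure DeformationData {T : TropicalAtlas X N Y} (c : WaveCocycle T) where
  finite : Finite c.A
  idx : c.A → ι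
  subset_dom : ∀ α, c.V α ⊆ T.dom (idx α)
  U : c.A → Set X
  isOpen_U : ∀ α, IsOpen (U α)
  cover_U : ⋃ α, U α = univ
  closure_U : ∀ α, closure (U α) ⊆ c.V α
  bounded : ∀ α β, Bornology.IsBounded (range ((c.sec α β).val (idx α)))

namespace DeformationData

variable {T : TropicalAtlas X N Y} {c : WaveCocycle T} (D : DeformationData c)

/-- The chart `φ_α` on `V_α`. -/
def phi (α : c.A) (x : X) (hx : x ∈ c.V α) : TropSpace (N (D.idx α)) :=
  T.chart (D.idx α) ⟨x, D.subset_dom α hx⟩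

/-- The vector `τ_{αβ}` at a point of `V_α ∩ V_β`, written in the chart `φ_α`. -/
def tau (α β : c.A) (z : X) (hz : z ∈ c.V α ∩ c.V β) : Fin (N (D.idx α)) → ℝ :=
  (c.sec α β).val (D.idx α) ⟨z, hz, D.subset_dom α hz.1⟩

theorem U_subset_V (α : c.A) : D.U α ⊆ c.V α := subset_closure.trans (D.closure_U α)

/-- The gluing relation on `⨆ U_α`: the points `x ∈ U_α` and `y ∈ U_β` are identified if
`ψ_{αβ} (φ_α x + ε τ_{αβ}) = φ_β y`, where `ψ_{αβ} = φ_β ∘ φ_α⁻¹` on `φ_α (V_α ∩ V_β)`;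
that is, if `φ_α x + ε τ_{αβ} = φ_α z` and `φ_β z = φ_β y` for some `z ∈ V_α ∩ V_β`. -/
def rel (ε : ℝ) (p q : Σ α, D.U α) : Prop :=
  ∃ (z : X) (hz : z ∈ c.V p.1 ∩ c.V q.1),
    translate (ε • D.tau p.1 q.1 z hz) (D.phi p.1 p.2 (D.U_subset_V _ p.2.2)) =
      D.phi p.1 z hz.1 ∧
    D.phi q.1 z hz.2 = D.phi q.1 q.2 (D.U_subset_V _ q.2.2)

/-- The deformation `X_{ετ}`, with the quotient topology. -/
def Space (ε : ℝ) : Type u := Quot (D.rel ε)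

instance (ε : ℝ) : TopologicalSpace (D.Space ε) :=
  inferInstanceAs (TopologicalSpace (Quot (D.rel ε)))

/-- The natural map `U_α → X_{ετ}`. -/
def incl (ε : ℝ) (α : c.A) (x : D.U α) : D.Space ε := Quot.mk _ ⟨α, x⟩

end DeformationData

end

end Tropical

namespace Tropical

open Matrix

/-! ## Systems of linear inequalities -/

/-! The geometric heart is that a point of a polyhedral complex can be moved a little along a wave
tangent vector without leaving the complex. At a finite point this follows from the definition of
the tangent cone. At a sedentary point `y` one takes a ray `q + s r` converging to `y` inside a
mobile face and moves `q` along the vector. Some facet contains the moved point and hence the whole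
face, so `r` is a recession direction of that facet, and the moved ray converges to the translate of
`y`. The ray exists because solvability of a finite linear system is a closed condition on its right
hand side (`isClosed_feasible`, `exists_ray_of_mem_closure`). A continuity argument along the
segment makes the amount of motion uniform near a point (`eventually_forall_translate_mem`).

The gluing is then a perturbation of the identity gluing. Since the vectors are bounded, glued
points are close to each other for small `ε` (`Glued.near`). Near a point of `X` the vectors are
constant and the overlap maps are affine with differentials matching the vectors, so the cocycle
identity gives symmetry and transitivity (`Glued.symm_near`, `Glued.trans_near`). Compactness yields
one bound on `ε` for all these local statements (`eventually_forall_of_isCompact`,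
`eventually_isSmall`).

For such `ε` the motion statement makes the maps `U_α → X_{ετ}` open, and the gluing relation is
closed, which gives the Hausdorff property. The new overlap maps are the old ones composed with
translations. For the finite type condition, a limit point on the boundary of `U_α` is still glued
to a point of some `U_β`.

The choices exist because a cocycle can be restricted to a finite cover shrunk inside charts, where
a locally constant function on a compact set is bounded (`exists_deformationData`). -/

theorem exists_between_of_finite {K L : Type*} [Finite K] [Finite L] (f : K → ℝ) (g : L → ℝ)
    (h : ∀ k l, f k ≤ g l) : ∃ x, (∀ k, f k ≤ x) ∧ ∀ l, x ≤ g l := by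
  rcases isEmpty_or_nonempty K with hK | hK
  · rcases isEmpty_or_nonempty L with hL | hL
    · exact ⟨0, fun k => hK.elim k, fun l => hL.elim l⟩
    · obtain ⟨l, hl⟩ := Finite.exists_min g
      exact ⟨g l, fun k => hK.elim k, hl⟩
  · obtain ⟨k, hk⟩ := Finite.exists_max f
    exact ⟨f k, hk, h k⟩

/-- The right hand sides for which a finite system of linear inequalities is solvable form a
closed set (Fourier–Motzkin elimination). -/
theorem isClosed_feasible (n : ℕ) : ∀ (K : Type) [Finite K] (A : K → Fin n → ℝ),
    IsClosed {b : K → ℝ | ∃ x : Fin n → ℝ, ∀ k, A k ⬝ᵥ x ≤ b k} := by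
  induction n with
  | zero =>
    intro K _ A
    have : {b : K → ℝ | ∃ x : Fin 0 → ℝ, ∀ k, A k ⬝ᵥ x ≤ b k} = ⋂ k, {b | 0 ≤ b k} := by
      ext b
      simp [dotProduct]
    rw [this]
    exact isClosed_iInter fun k => isClosed_le continuous_const (continuous_apply k)
  | succ n ih =>
    intro K _ A
    classical
    -- The variable `x 0` is eliminated: two rows with opposite signs in column 0 combine into a row
    -- without it, and rows with coefficient 0 are kept. The new right hand side depends
    -- continuously on `b`, so closedness pulls back from dimension `n`.
    let P : K × K → Prop := fun p => 0 < A p.1 0 ∧ A p.2 0 < 0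
    let Z : K → Prop := fun k => A k 0 = 0
    let A' : {p // P p} ⊕ {k // Z k} → Fin n → ℝ := Sum.elim
      (fun p => A p.1.1 0 • vecTail (A p.1.2) - A p.1.2 0 • vecTail (A p.1.1))
      (fun k => vecTail (A k.1))
    let b' : (K → ℝ) → {p // P p} ⊕ {k // Z k} → ℝ := fun b => Sum.elim
      (fun p => A p.1.1 0 * b p.1.2 - A p.1.2 0 * b p.1.1) (fun k => b k.1)
    have hb' : Continuous b' := by
      refine continuous_pi fun k => ?_
      rcases k with p | k
      · exact (continuous_const.mul (continuous_apply _)).sub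
          (continuous_const.mul (continuous_apply _))
      · exact continuous_apply _
    have hdot : ∀ k (x : Fin (n + 1) → ℝ), A k ⬝ᵥ x = A k 0 * x 0 + vecTail (A k) ⬝ᵥ vecTail x := by
      intro k x
      simp [dotProduct, Fin.sum_univ_succ, vecTail]
    convert (ih _ A').preimage hb' using 1
    ext b
    simp only [mem_ofPred_eq, mem_preimage]
    constructor
    · rintro ⟨x, hx⟩
      refine ⟨vecTail x, ?_⟩
      rintro (⟨⟨k, l⟩, hk, hl⟩ | ⟨k, hk⟩)
      · have h1 := hx k
        have h2 := hx l
        rw [hdot] at h1 h2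
        simp only [A', b', Sum.elim_inl, sub_dotProduct, smul_dotProduct, smul_eq_mul]
        simp only at hk hl
        have h3 := mul_le_mul_of_nonneg_left h2 hk.le
        have h4 := mul_le_mul_of_nonneg_left h1 (neg_pos.2 hl).le
        linarith
      · have h1 := hx k
        rw [hdot, show A k 0 = 0 from hk] at h1
        simpa [A', b'] using h1
    · rintro ⟨x, hx⟩
      -- Rows with negative coefficient bound `x 0` from below, rows with positive coefficient from
      -- above; the combined rows say that every lower bound is at most every upper bound.
      obtain ⟨t, ht1, ht2⟩ := exists_between_of_finite
        (fun l : {l // A l 0 < 0} => (b l - vecTail (A l) ⬝ᵥ x) / A l 0)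
        (fun k : {k // 0 < A k 0} => (b k - vecTail (A k) ⬝ᵥ x) / A k 0) (by
          rintro ⟨l, hl⟩ ⟨k, hk⟩
          have := hx (Sum.inl ⟨(k, l), hk, hl⟩)
          simp only [A', b', Sum.elim_inl, sub_dotProduct, smul_dotProduct, smul_eq_mul] at this
          rw [div_le_iff_of_neg hl, div_mul_eq_mul_div, div_le_iff₀ hk]
          linarith)
      refine ⟨vecCons t x, fun k => ?_⟩
      rw [hdot]
      simp only [cons_val_zero, tail_cons]
      rcases lt_trichotomy (A k 0) 0 with hk | hk | hk
      · have := ht1 ⟨k, hk⟩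
        rw [div_le_iff_of_neg hk] at this
        linarith
      · have := hx (Sum.inr ⟨k, hk⟩)
        simp only [A', b', Sum.elim_inr] at this
        rw [hk]
        linarith
      · have := ht2 ⟨k, hk⟩
        rw [le_div_iff₀ hk] at this
        linarith

/-! ## Topology of tropical affine space -/

variable {N : ℕ}

theorem isEmbedding_toTrop : IsEmbedding (toTrop : (Fin N → ℝ) → TropSpace N) := by
  have h : IsEmbedding ofReal := .of_comp (continuous_coe_real_ereal.subtype_mk _)
    continuous_subtype_val EReal.isEmbedding_coe
  exact IsEmbedding.piMap fun _ => h

theorem tendsto_tropSpace_iff {α : Type*} {l : Filter α} {f : α → TropSpace N} {y : TropSpace N} :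
    Tendsto f l (𝓝 y) ↔ ∀ i, Tendsto (fun a => (f a i : EReal)) l (𝓝 (y i : EReal)) := by
  simp only [tendsto_pi_nhds, tendsto_subtype_rng]

theorem coe_toTrop (x : Fin N → ℝ) (i : Fin N) : (toTrop x i : EReal) = (x i : EReal) := rfl

theorem coe_stratumEmb_of_mem {I : Finset (Fin N)} (x : {i : Fin N // i ∉ I} → ℝ) {i : Fin N}
    (hi : i ∈ I) : (stratumEmb I x i : EReal) = ⊥ := by
  simp [stratumEmb, hi, negInf]

theorem coe_stratumEmb_of_notMem {I : Finset (Fin N)} (x : {i : Fin N // i ∉ I} → ℝ) {i : Fin N}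
    (hi : i ∉ I) : (stratumEmb I x i : EReal) = (x ⟨i, hi⟩ : EReal) := by
  simp [stratumEmb, hi, ofReal]

theorem eq_negInf_iff {x : TropNum} : x = negInf ↔ (x : EReal) = ⊥ := by
  rw [Subtype.ext_iff]; rfl

theorem exists_stratumEmb_eq (y : TropSpace N) :
    ∃ (I : Finset (Fin N)) (x : {i : Fin N // i ∉ I} → ℝ), stratumEmb I x = y := by
  classical
  refine ⟨Finset.univ.filter fun i => (y i : EReal) = ⊥, fun i => (y i : EReal).toReal, ?_⟩
  funext i
  apply Subtype.ext
  by_cases hi : (y i : EReal) = ⊥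
  · rw [coe_stratumEmb_of_mem _ (by simpa using hi), hi]
  · rw [coe_stratumEmb_of_notMem _ (by simpa using hi)]
    exact EReal.coe_toReal (y i).2 hi

theorem translate_stratumEmb (v : Fin N → ℝ) (I : Finset (Fin N)) (x : {i : Fin N // i ∉ I} → ℝ) :
    translate v (stratumEmb I x) = stratumEmb I (fun i => x i + v i) := by
  funext i
  apply Subtype.ext
  change (stratumEmb I x i : EReal) + (v i : EReal) = _
  by_cases hi : i ∈ I
  · rw [coe_stratumEmb_of_mem _ hi, coe_stratumEmb_of_mem _ hi, EReal.bot_add]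
  · rw [coe_stratumEmb_of_notMem _ hi, coe_stratumEmb_of_notMem _ hi, EReal.coe_add]

/-- Addition of extended reals fails to be continuous only at `⊥ + ⊤` and `⊤ + ⊥`, and neither
summand is ever `⊤` here. -/
theorem continuous_translate :
    Continuous fun p : (Fin N → ℝ) × TropSpace N => translate p.1 p.2 := by
  refine continuous_pi fun i => Continuous.subtype_mk ?_ _
  refine continuous_iff_continuousAt.2 fun p => ?_
  have h := EReal.continuousAt_add (p := (((p.2 i : TropNum) : EReal), ((p.1 i : ℝ) : EReal)))
    (Or.inl (p.2 i).2) (Or.inr (EReal.coe_ne_top _))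
  refine ContinuousAt.comp (f := fun q : (Fin N → ℝ) × TropSpace N =>
    (((q.2 i : TropNum) : EReal), ((q.1 i : ℝ) : EReal))) h ?_
  have h1 : Continuous fun q : (Fin N → ℝ) × TropSpace N => ((q.2 i : TropNum) : EReal) := by
    fun_prop
  have h2 : Continuous fun q : (Fin N → ℝ) × TropSpace N => ((q.1 i : ℝ) : EReal) :=
    continuous_coe_real_ereal.comp (by fun_prop)
  exact (h1.prodMk h2).continuousAt

theorem translate_zero (y : TropSpace N) : translate 0 y = y := by
  funext i
  apply Subtype.ext
  change (y i : EReal) + ((0 : ℝ) : EReal) = _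
  simp

theorem translate_translate (v w : Fin N → ℝ) (y : TropSpace N) :
    translate v (translate w y) = translate (w + v) y := by
  funext i
  apply Subtype.ext
  change (y i : EReal) + (w i : EReal) + (v i : EReal) = (y i : EReal) + ((w i + v i : ℝ) : EReal)
  rw [EReal.coe_add, add_assoc]

theorem tendsto_ray {I : Finset (Fin N)} {x : {i : Fin N // i ∉ I} → ℝ} {q r : Fin N → ℝ}
    (hq : ∀ i : {i // i ∉ I}, q i = x i) (hr : ∀ i ∈ I, r i < 0) (hr0 : ∀ i ∉ I, r i = 0) :
    Tendsto (fun s : ℝ => toTrop (q + s • r)) atTop (𝓝 (stratumEmb I x)) := by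
  rw [tendsto_tropSpace_iff]
  intro i
  by_cases hi : i ∈ I
  · rw [coe_stratumEmb_of_mem _ hi]
    refine EReal.tendsto_coe_nhds_bot_iff.2 ?_
    simp only [Pi.add_apply, Pi.smul_apply, smul_eq_mul]
    exact tendsto_atBot_add_const_left _ _ (tendsto_id.atTop_mul_const_of_neg (hr i hi))
  · rw [coe_stratumEmb_of_notMem _ hi]
    simp only [coe_toTrop, Pi.add_apply, Pi.smul_apply, hr0 i hi, smul_zero, add_zero, ← hq ⟨i, hi⟩]
    exact tendsto_const_nhds

theorem stratumEmb_mem_closure {I : Finset (Fin N)} {x : {i : Fin N // i ∉ I} → ℝ}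
    {q r : Fin N → ℝ} {P : Set (Fin N → ℝ)}
    (hq : ∀ i : {i // i ∉ I}, q i = x i) (hr : ∀ i ∈ I, r i < 0) (hr0 : ∀ i ∉ I, r i = 0)
    (hP : ∀ s : ℝ, 0 ≤ s → q + s • r ∈ P) : stratumEmb I x ∈ closure (toTrop '' P) :=
  mem_closure_of_tendsto (tendsto_ray hq hr hr0)
    ((eventually_ge_atTop 0).mono fun s hs => mem_image_of_mem _ (hP s hs))

/-- A polyhedron whose closure contains a sedentary point has a ray converging to that point. -/
theorem exists_ray_of_mem_closure {K : Type} [Finite K] (A : K → Fin N → ℝ) (b : K → ℝ)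
    {I : Finset (Fin N)} {x : {i : Fin N // i ∉ I} → ℝ}
    (hx : stratumEmb I x ∈ closure (toTrop '' {z : Fin N → ℝ | ∀ k, A k ⬝ᵥ z ≤ b k})) :
    ∃ q r : Fin N → ℝ, (∀ k, A k ⬝ᵥ q ≤ b k) ∧ (∀ i : {i // i ∉ I}, q i = x i) ∧
      (∀ k, A k ⬝ᵥ r ≤ 0) ∧ (∀ i ∈ I, r i < 0) ∧ ∀ i ∉ I, r i = 0 := by
  classical
  have approx : ∀ n : ℕ, ∃ z : Fin N → ℝ, (∀ k, A k ⬝ᵥ z ≤ b k) ∧ (∀ i ∈ I, z i < -(n + 1 : ℝ)) ∧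
      ∀ i : {i // i ∉ I}, |z i - x i| < 1 / (n + 1 : ℝ) := by
    intro n
    have hpos : (0 : ℝ) < 1 / (n + 1 : ℝ) := by positivity
    let G : Set (TropSpace N) := {y | ∀ i, if hi : i ∈ I then (y i : EReal) < ((-(n + 1 : ℝ) : ℝ) : EReal)
      else ((x ⟨i, hi⟩ - 1 / (n + 1 : ℝ) : ℝ) : EReal) < y i ∧
        (y i : EReal) < ((x ⟨i, hi⟩ + 1 / (n + 1 : ℝ) : ℝ) : EReal)}
    have hG : IsOpen G := by
      have : G = ⋂ i, {y | if hi : i ∈ I then (y i : EReal) < ((-(n + 1 : ℝ) : ℝ) : EReal)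
        else ((x ⟨i, hi⟩ - 1 / (n + 1 : ℝ) : ℝ) : EReal) < y i ∧
        (y i : EReal) < ((x ⟨i, hi⟩ + 1 / (n + 1 : ℝ) : ℝ) : EReal)} := by
        ext y; simp [G]
      rw [this]
      refine isOpen_iInter_of_finite fun i => ?_
      have hc : Continuous fun y : TropSpace N => (y i : EReal) := by fun_prop
      by_cases hi : i ∈ I
      · simp only [hi, dif_pos]
        exact isOpen_lt hc continuous_const
      · simp only [hi, dif_neg, not_false_eq_true]
        exact (isOpen_lt continuous_const hc).inter (isOpen_lt hc continuous_const)
    have hxG : stratumEmb I x ∈ G := by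
      intro i
      by_cases hi : i ∈ I
      · simp only [hi, dif_pos, coe_stratumEmb_of_mem]
        exact EReal.bot_lt_coe _
      · simp only [hi, dif_neg, not_false_eq_true, coe_stratumEmb_of_notMem]
        exact ⟨EReal.coe_lt_coe_iff.2 (by linarith), EReal.coe_lt_coe_iff.2 (by linarith)⟩
    obtain ⟨_, hzG, z, hz, rfl⟩ := mem_closure_iff.1 hx G hG hxG
    refine ⟨z, hz, fun i hi => ?_, fun i => ?_⟩
    · have := hzG i
      simp only [hi, dif_pos, coe_toTrop] at this
      exact EReal.coe_lt_coe_iff.1 this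
    · have := hzG i
      simp only [i.2, dif_neg, not_false_eq_true, coe_toTrop, EReal.coe_lt_coe_iff] at this
      rw [abs_lt]
      constructor <;> linarith [this.1, this.2]
  choose z hzA hzI hzx using approx
  have h0 : Tendsto (fun n : ℕ => 1 / (n + 1 : ℝ)) atTop (𝓝 0) := tendsto_one_div_add_atTop_nhds_zero_nat
  let J := {i : Fin N // i ∉ I}
  -- the finite part
  have hq : ∃ q : Fin N → ℝ, (∀ k, A k ⬝ᵥ q ≤ b k) ∧ ∀ i : J, q i = x i := by
    -- The polyhedron together with `|q i - x i| ≤ e` for finite coordinates: solvable for `e = 1 /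
    -- (n + 1)`, hence also for the limit value `e = 0`.
    let B : K ⊕ J ⊕ J → Fin N → ℝ :=
      Sum.elim A (Sum.elim (fun i => Pi.single i.1 1) (fun i => -Pi.single i.1 1))
    let c : ℝ → K ⊕ J ⊕ J → ℝ :=
      fun e => Sum.elim b (Sum.elim (fun i => x i + e) (fun i => - x i + e))
    have hc : Continuous c := by
      refine continuous_pi fun k => ?_
      rcases k with k | i | i
      · exact continuous_const
      · exact continuous_const.add continuous_id
      · exact continuous_const.add continuous_id
    have hmem := (isClosed_feasible N _ B).mem_of_tendsto
      ((hc.tendsto 0).comp h0) (Eventually.of_forall fun n => ⟨z n, by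
        rintro (k | i | i)
        · exact hzA n k
        · have := abs_lt.1 (hzx n i)
          simp only [B, c, Function.comp, Sum.elim_inl, Sum.elim_inr, single_dotProduct, one_mul]
          linarith
        · have := abs_lt.1 (hzx n i)
          simp only [B, c, Function.comp, Sum.elim_inr, neg_dotProduct, single_dotProduct, one_mul]
          linarith⟩)
    obtain ⟨q, hq⟩ := hmem
    refine ⟨q, fun k => hq (Sum.inl k), fun i => ?_⟩
    have h1 := hq (Sum.inr (Sum.inl i))
    have h2 := hq (Sum.inr (Sum.inr i))
    simp only [B, c, Sum.elim_inl, Sum.elim_inr, neg_dotProduct, single_dotProduct, one_mul] at h1 h2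
    linarith
  have hr : ∃ r : Fin N → ℝ, (∀ k, A k ⬝ᵥ r ≤ 0) ∧ (∀ i ∈ I, r i < 0) ∧ ∀ i ∉ I, r i = 0 := by
    -- The approximating points are rescaled by `e = 1 / (n + 1)`: their coordinates in `I` stay at
    -- most `-1`, while all other right hand sides tend to 0. The limit system describes the
    -- direction of the ray.
    let B : K ⊕ {i // i ∈ I} ⊕ J ⊕ J → Fin N → ℝ := Sum.elim A
      (Sum.elim (fun i => Pi.single i.1 1)
        (Sum.elim (fun i => Pi.single i.1 1) (fun i => -Pi.single i.1 1)))
    let c : ℝ → K ⊕ {i // i ∈ I} ⊕ J ⊕ J → ℝ := fun e => Sum.elim (fun k => e * b k)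
      (Sum.elim (fun _ => -1)
        (Sum.elim (fun i => e * (x i + 1)) (fun i => e * (- x i + 1))))
    have hc : Continuous c := by
      refine continuous_pi fun k => ?_
      rcases k with k | k | i | i
      · exact continuous_id.mul continuous_const
      · exact continuous_const
      · exact continuous_id.mul continuous_const
      · exact continuous_id.mul continuous_const
    have hmem := (isClosed_feasible N _ B).mem_of_tendsto
      ((hc.tendsto 0).comp h0) (Eventually.of_forall fun n => ⟨(1 / (n + 1 : ℝ)) • z n, by
        have hpos : (0 : ℝ) < 1 / (n + 1 : ℝ) := by positivity
        have hle : 1 / (n + 1 : ℝ) ≤ 1 := by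
          rw [div_le_one (by positivity)]
          linarith [Nat.cast_nonneg (α := ℝ) n]
        intro k
        rw [dotProduct_smul, smul_eq_mul]
        rcases k with k | i | i | i
        · exact mul_le_mul_of_nonneg_left (hzA n k) hpos.le
        · have := hzI n i i.2
          simp only [B, c, Function.comp, Sum.elim_inl, Sum.elim_inr, single_dotProduct, one_mul]
          rw [div_mul_eq_mul_div, div_le_iff₀ (by positivity)]
          linarith
        · have := abs_lt.1 (hzx n i)
          simp only [B, c, Function.comp, Sum.elim_inl, Sum.elim_inr, single_dotProduct, one_mul]
          exact mul_le_mul_of_nonneg_left (by linarith) hpos.le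
        · have := abs_lt.1 (hzx n i)
          simp only [B, c, Function.comp, Sum.elim_inr, neg_dotProduct, single_dotProduct, one_mul]
          exact mul_le_mul_of_nonneg_left (by linarith) hpos.le⟩)
    obtain ⟨r, hr⟩ := hmem
    refine ⟨r, fun k => ?_, fun i hi => ?_, fun i hi => ?_⟩
    · simpa [B, c] using hr (Sum.inl k)
    · have h1 := hr (Sum.inr (Sum.inl ⟨i, hi⟩))
      simp only [B, c, Sum.elim_inl, Sum.elim_inr, single_dotProduct, one_mul] at h1
      linarith
    · have h1 := hr (Sum.inr (Sum.inr (Sum.inl ⟨i, hi⟩)))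
      have h2 := hr (Sum.inr (Sum.inr (Sum.inr ⟨i, hi⟩)))
      simp only [B, c, Sum.elim_inl, Sum.elim_inr, neg_dotProduct, single_dotProduct, one_mul,
        zero_mul] at h1 h2
      linarith
  obtain ⟨q, hq1, hq2⟩ := hq
  obtain ⟨r, hr1, hr2, hr3⟩ := hr
  exact ⟨q, r, hq1, hq2, hr1, hr2, hr3⟩

end Tropical

namespace Tropical

open Matrix

variable {N : ℕ}

/-! ## Faces and their relative interiors -/

/-- The affine span lies in `z + L`, so a neighbourhood of `z` in `z + L` restricts to one in the
span; the span itself need not be computed. -/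
theorem mem_intrinsicInterior_of_eventually {V : Type*} [NormedAddCommGroup V] [NormedSpace ℝ V]
    {s : Set V} {z : V} {L : Submodule ℝ V} (hL : ∀ a ∈ s, a - z ∈ L)
    (h : ∀ᶠ v : L in 𝓝 0, z + v ∈ s) : z ∈ intrinsicInterior ℝ s := by
  have hz : z ∈ s := by simpa using h.self_of_nhds
  have hle : affineSpan ℝ s ≤ AffineSubspace.mk' z L := affineSpan_le.2 fun a ha => hL a ha
  refine mem_intrinsicInterior.2 ⟨⟨z, subset_affineSpan ℝ s hz⟩, ?_, rfl⟩
  rw [mem_interior_iff_mem_nhds]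
  let f : affineSpan ℝ s → L := fun a => ⟨a - z, hle a.2⟩
  have hf : Continuous f := (continuous_subtype_val.sub continuous_const).subtype_mk _
  have hf0 : Tendsto f (𝓝 ⟨z, subset_affineSpan ℝ s hz⟩) (𝓝 0) := by
    have := hf.tendsto ⟨z, subset_affineSpan ℝ s hz⟩
    rwa [show f ⟨z, subset_affineSpan ℝ s hz⟩ = 0 from Subtype.ext (sub_self z)] at this
  filter_upwards [hf0.eventually h] with a ha
  simpa [f] using ha

theorem dotProduct_continuous (c : Fin N → ℝ) : Continuous fun x : Fin N → ℝ => c ⬝ᵥ x :=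
  continuous_const.dotProduct continuous_id

/-- The real linear form of an integral inequality. -/
noncomputable def form (h : (Fin N → ℤ) × ℝ) : Fin N → ℝ := fun i => (h.1 i : ℝ)

theorem mem_ratPolyhedron {H : Finset ((Fin N → ℤ) × ℝ)} {x : Fin N → ℝ} :
    x ∈ ratPolyhedron H ↔ ∀ h ∈ H, form h ⬝ᵥ x ≤ h.2 := Iff.rfl

theorem mem_ratFace {H S : Finset ((Fin N → ℤ) × ℝ)} {x : Fin N → ℝ} :
    x ∈ ratFace H S ↔ (∀ h ∈ H, form h ⬝ᵥ x ≤ h.2) ∧ ∀ h ∈ S, form h ⬝ᵥ x = h.2 := Iff.rfl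

theorem isClosed_ratPolyhedron (H : Finset ((Fin N → ℤ) × ℝ)) : IsClosed (ratPolyhedron H) := by
  have : ratPolyhedron H = ⋂ h ∈ H, {x | form h ⬝ᵥ x ≤ h.2} := by
    ext x; simp [mem_ratPolyhedron]
  rw [this]
  exact isClosed_biInter fun h _ => isClosed_le (dotProduct_continuous _) continuous_const

theorem isClosed_ratFace (H S : Finset ((Fin N → ℤ) × ℝ)) : IsClosed (ratFace H S) := by
  have : ratFace H S = ratPolyhedron H ∩ ⋂ h ∈ S, {x | form h ⬝ᵥ x = h.2} := by
    ext x; simp [mem_ratFace, mem_ratPolyhedron]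
  rw [this]
  exact (isClosed_ratPolyhedron H).inter
    (isClosed_biInter fun h _ => isClosed_eq (dotProduct_continuous _) continuous_const)

theorem mobilePart_closure {P : Set (Fin N → ℝ)} (hP : IsClosed P) :
    mobilePart (closure (toTrop '' P)) = P := by
  rw [mobilePart, ← isEmbedding_toTrop.isInducing.closure_eq_preimage_closure_image, hP.closure_eq]

/-- The linear space of directions on which the forms in `S` vanish. -/
def nullSpace (S : Finset ((Fin N → ℤ) × ℝ)) : Submodule ℝ (Fin N → ℝ) where
  carrier := {v | ∀ h ∈ S, form h ⬝ᵥ v = 0}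
  zero_mem' := fun h _ => dotProduct_zero _
  add_mem' := fun {a b} ha hb h hh => by rw [dotProduct_add, ha h hh, hb h hh, add_zero]
  smul_mem' := fun c a ha h hh => by rw [dotProduct_smul, ha h hh, smul_zero]

theorem mem_nullSpace {S : Finset ((Fin N → ℤ) × ℝ)} {v : Fin N → ℝ} :
    v ∈ nullSpace S ↔ ∀ h ∈ S, form h ⬝ᵥ v = 0 := Iff.rfl

/-- The equalities in `S` persist along its null space, and the remaining inequalities are strict at
`q`, an open condition. -/
theorem eventually_add_mem_ratFace {H S : Finset ((Fin N → ℤ) × ℝ)} {q : Fin N → ℝ}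
    (hq : q ∈ ratFace H S) (hS : ∀ h ∈ H, h ∉ S → form h ⬝ᵥ q < h.2) :
    ∀ᶠ v : nullSpace S in 𝓝 0, q + v ∈ ratFace H S := by
  have key : ∀ h ∈ H, h ∉ S → ∀ᶠ v : nullSpace S in 𝓝 0, form h ⬝ᵥ (q + v) < h.2 := by
    intro h hH hhS
    have hc : Continuous fun v : nullSpace S => form h ⬝ᵥ (q + v) :=
      (dotProduct_continuous _).comp (continuous_const.add continuous_subtype_val)
    refine (hc.tendsto 0).eventually_lt_const ?_
    simpa using hS h hH hhS
  have key' : ∀ᶠ v : nullSpace S in 𝓝 0, ∀ h ∈ H, h ∉ S → form h ⬝ᵥ (q + v) < h.2 := by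
    refine (Filter.eventually_all_finset H).2 fun h hh => ?_
    by_cases hhS : h ∈ S
    · exact Eventually.of_forall fun v hv => (hv hhS).elim
    · exact (key h hh hhS).mono fun v hv _ => hv
  filter_upwards [key'] with v hv
  have hS' : ∀ h ∈ S, form h ⬝ᵥ (q + v) = h.2 := fun h hh => by
    rw [dotProduct_add, hq.2 h hh |> (id : form h ⬝ᵥ q = h.2 → _), mem_nullSpace.1 v.2 h hh, add_zero]
  refine mem_ratFace.2 ⟨fun h hh => ?_, hS'⟩
  by_cases hhS : h ∈ S
  · exact (hS' h hhS).le
  · exact (hv h hh hhS).le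

/-- A face is itself a polyhedron once each equality is written with an additional reversed
inequality, so `exists_ray_of_mem_closure` applies. -/
theorem exists_ray_ratFace {H S : Finset ((Fin N → ℤ) × ℝ)} (hSH : S ⊆ H) {I : Finset (Fin N)}
    {x : {i : Fin N // i ∉ I} → ℝ} (hx : stratumEmb I x ∈ closure (toTrop '' ratFace H S)) :
    ∃ q r : Fin N → ℝ, q ∈ ratFace H S ∧ (∀ i : {i // i ∉ I}, q i = x i) ∧
      (∀ h ∈ H, form h ⬝ᵥ r ≤ 0) ∧ (∀ i ∈ I, r i < 0) ∧ ∀ i ∉ I, r i = 0 := by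
  let A : {h // h ∈ H} ⊕ {h // h ∈ S} → Fin N → ℝ :=
    Sum.elim (fun h => form h.1) (fun h => -form h.1)
  let b : {h // h ∈ H} ⊕ {h // h ∈ S} → ℝ := Sum.elim (fun h => h.1.2) (fun h => -h.1.2)
  have hP : ratFace H S = {z | ∀ k, A k ⬝ᵥ z ≤ b k} := by
    ext z
    rw [mem_ratFace]
    constructor
    · rintro ⟨h1, h2⟩ (h | h)
      · exact h1 h h.2
      · simp only [A, b, Sum.elim_inr, neg_dotProduct]
        exact (neg_le_neg_iff.2 (h2 h h.2).ge)
    · intro hz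
      have h1 : ∀ h ∈ H, form h ⬝ᵥ z ≤ h.2 := fun h hh => hz (Sum.inl ⟨h, hh⟩)
      refine ⟨h1, fun h hh => le_antisymm (h1 h (hSH hh)) ?_⟩
      have := hz (Sum.inr ⟨h, hh⟩)
      simp only [A, b, Sum.elim_inr, neg_dotProduct] at this
      linarith
  rw [hP] at hx ⊢
  obtain ⟨q, r, h1, h2, h3, h4, h5⟩ := exists_ray_of_mem_closure A b hx
  exact ⟨q, r, h1, h2, fun h hh => h3 (Sum.inl ⟨h, hh⟩), h4, h5⟩

theorem dotProduct_nonpos_of_ray_subset {H : Finset ((Fin N → ℤ) × ℝ)} {q r : Fin N → ℝ}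
    (h : ∀ s : ℝ, 0 ≤ s → q + s • r ∈ ratPolyhedron H) : ∀ k ∈ H, form k ⬝ᵥ r ≤ 0 := by
  intro k hk
  by_contra! hpos
  have hq : form k ⬝ᵥ q ≤ k.2 := by
    have := h 0 le_rfl
    rw [zero_smul, add_zero] at this
    exact this k hk
  -- At this parameter the form takes the value `k.2 + 1`.
  have := h ((k.2 - form k ⬝ᵥ q + 1) / (form k ⬝ᵥ r))
    (div_nonneg (by linarith) hpos.le) k hk
  change form k ⬝ᵥ _ ≤ _ at this
  rw [dotProduct_add, dotProduct_smul, smul_eq_mul, div_mul_cancel₀ _ hpos.ne'] at this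
  linarith

theorem add_ray_mem_ratFace {H S : Finset ((Fin N → ℤ) × ℝ)} {q r : Fin N → ℝ}
    (hq : q ∈ ratFace H S) (hr : ∀ h ∈ H, form h ⬝ᵥ r ≤ 0) (hS : ∀ h ∈ S, form h ⬝ᵥ r = 0)
    (s : ℝ) (hs : 0 ≤ s) : q + s • r ∈ ratFace H S := by
  rw [mem_ratFace] at hq ⊢
  refine ⟨fun h hh => ?_, fun h hh => ?_⟩
  · rw [dotProduct_add, dotProduct_smul, smul_eq_mul]
    have := mul_nonpos_of_nonneg_of_nonpos hs (hr h hh)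
    linarith [hq.1 h hh]
  · rw [dotProduct_add, dotProduct_smul, hS h hh, hq.2 h hh, smul_zero, add_zero]

/-- Every point of a polyhedral domain lies in the relative interior of a stratum of some mobile
face, and it is the limit of a ray in that face. -/
theorem exists_face_ray {H : Finset ((Fin N → ℤ) × ℝ)} {I : Finset (Fin N)}
    {x : {i : Fin N // i ∉ I} → ℝ} (hx : stratumEmb I x ∈ closure (toTrop '' ratPolyhedron H)) :
    ∃ (S : Finset ((Fin N → ℤ) × ℝ)) (q r : Fin N → ℝ), S ⊆ H ∧ q ∈ ratFace H S ∧
      (∀ᶠ v : nullSpace S in 𝓝 0, q + v ∈ ratFace H S) ∧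
      (∀ s : ℝ, 0 ≤ s → q + s • r ∈ ratFace H S) ∧
      (∀ i : {i // i ∉ I}, q i = x i) ∧ (∀ i ∈ I, r i < 0) ∧ (∀ i ∉ I, r i = 0) ∧
      x ∈ intrinsicInterior ℝ (stratumEmb I ⁻¹' closure (toTrop '' ratFace H S)) := by
  classical
  have h0 : ratPolyhedron H = ratFace H ∅ := by ext; simp [mem_ratFace, mem_ratPolyhedron]
  rw [h0] at hx
  obtain ⟨q₀, r, hq₀, hq₀x, hr, hrI, hrI'⟩ := exists_ray_ratFace (Finset.empty_subset H) hx
  rw [mem_ratFace] at hq₀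
  -- The inequalities tight at `q₀ + r` rather than at `q₀`: tightness there forces the form to
  -- vanish on `r`, so the ray stays in the face cut out by `S`.
  let S := H.filter fun h => form h ⬝ᵥ (q₀ + r) = h.2
  have hSH : S ⊆ H := Finset.filter_subset _ _
  have hqH : ∀ h ∈ H, form h ⬝ᵥ (q₀ + r) ≤ h.2 := fun h hh => by
    rw [dotProduct_add]; linarith [hr h hh, hq₀.1 h hh]
  have hq : q₀ + r ∈ ratFace H S :=
    mem_ratFace.2 ⟨hqH, fun h hh => (Finset.mem_filter.1 hh).2⟩
  have hrS : ∀ h ∈ S, form h ⬝ᵥ r = 0 := fun h hh => by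
    have h1 := (Finset.mem_filter.1 hh).2
    rw [dotProduct_add] at h1
    linarith [hr h (hSH hh), hq₀.1 h (hSH hh)]
  have hev := eventually_add_mem_ratFace hq fun h hh hhS =>
    lt_of_le_of_ne (hqH h hh) fun he => hhS (Finset.mem_filter.2 ⟨hh, he⟩)
  have hqx : ∀ i : {i // i ∉ I}, (q₀ + r) i = x i := fun i => by
    rw [Pi.add_apply, hrI' i i.2, hq₀x i, add_zero]
  refine ⟨S, q₀ + r, r, hSH, hq, hev, add_ray_mem_ratFace hq hr hrS, hqx, hrI, hrI', ?_⟩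
  -- Forgetting the coordinates in `I` maps the directions of the face onto those of its stratum. A
  -- linear section `σ` lifts a small displacement of `x` to one of the base point, and the same
  -- direction `r` leads to the displaced point at infinity.
  let π : (Fin N → ℝ) →ₗ[ℝ] ({i // i ∉ I} → ℝ) := LinearMap.funLeft ℝ ℝ Subtype.val
  let L := (nullSpace S).map π
  let f : nullSpace S →ₗ[ℝ] L := π.submoduleMap (nullSpace S)
  obtain ⟨σ, hσ⟩ := f.exists_rightInverse_of_surjective
    (LinearMap.range_eq_top.2 (π.submoduleMap_surjective (nullSpace S)))
  have hσ0 : Tendsto σ (𝓝 0) (𝓝 0) := by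
    simpa using (LinearMap.continuous_of_finiteDimensional σ).tendsto 0
  refine mem_intrinsicInterior_of_eventually (L := L) (fun a ha => ?_) ?_
  · obtain ⟨q', r', hq', hq'a, -⟩ := exists_ray_ratFace hSH ha
    refine ⟨q' - (q₀ + r), fun h hh => ?_, ?_⟩
    · rw [dotProduct_sub, (mem_ratFace.1 hq').2 h hh, (mem_ratFace.1 hq).2 h hh, sub_self]
    · funext i
      change q' i - (q₀ + r) i = a i - x i
      rw [hq'a, hqx]
  · filter_upwards [hσ0.eventually hev] with v hv
    refine stratumEmb_mem_closure (q := q₀ + r + (σ v : Fin N → ℝ)) (fun i => ?_) hrI hrI'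
      (add_ray_mem_ratFace hv hr hrS)
    have h1 : π (σ v : Fin N → ℝ) = v := congrArg Subtype.val (LinearMap.congr_fun hσ v)
    rw [Pi.add_apply, hqx, Pi.add_apply, ← h1]
    rfl

/-! ## Wave tangent vectors -/

/-- The infimum lies in every member of the family, and the family is nonempty: as `p` is in the
support, the cone contains `⊥`, which extends to a maximal subspace by the ascending chain
condition. -/
theorem PolyhedralComplex.mobileWave_subset_tangentCone (Y : PolyhedralComplex N) {p : Fin N → ℝ}
    (hp : toTrop p ∈ Y.support) : (Y.mobileWave p : Set (Fin N → ℝ)) ⊆ Y.tangentCone p := by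
  obtain ⟨L, -, hL⟩ := exists_maximal_ge_of_wellFoundedGT
    (fun L : Submodule ℝ (Fin N → ℝ) => (L : Set (Fin N → ℝ)) ⊆ Y.tangentCone p) ⊥ (by
      rintro w hw
      obtain rfl : w = 0 := by simpa using hw
      exact Eventually.of_forall (f := 𝓝[>] (0 : ℝ)) fun t => by
        rwa [smul_zero, add_zero])
  exact fun w hw => hL.prop ((sInf_le (a := L) hL : Y.mobileWave p ≤ L) hw)

theorem PolyhedralComplex.isClosed_support (Y : PolyhedralComplex N) : IsClosed Y.support := by
  rw [support, sUnion_eq_biUnion]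
  refine Y.facets.finite_toSet.isClosed_biUnion fun D hD => ?_
  obtain ⟨H, -, rfl⟩ := Y.isDomain D hD
  exact isClosed_closure

/-- A facet that meets the relative interior of a face contains this face. -/
theorem PolyhedralComplex.subset_facet (Y : PolyhedralComplex N) {D F : Set (TropSpace N)}
    (hD : D ∈ Y.facets) (hF : F ∈ Y.facets) {P : Set (Fin N → ℝ)} (hP : toTrop '' P ⊆ D)
    {q : Fin N → ℝ} (hqF : toTrop q ∈ F) (hqP : q ∈ P)
    (hint : ∀ e ∈ P, ∃ t : ℝ, 0 < t ∧ q + t • (q - e) ∈ P) : toTrop '' P ⊆ F := by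
  classical
  have hqDF : toTrop q ∈ ⋂₀ (({D, F} : Finset (Set (TropSpace N))) : Set (Set (TropSpace N))) := by
    simpa using ⟨hP (mem_image_of_mem _ hqP), hqF⟩
  rcases Y.inter_face {D, F} (by simp [Finset.insert_subset_iff, hD, hF]) D (by simp) with h | h
  · exact (h ▸ hqDF).elim
  obtain ⟨H, S, hSH, -, hDH, hE⟩ := h
  have hPH : P ⊆ ratPolyhedron H := by
    rw [← mobilePart_closure (isClosed_ratPolyhedron H), ← hDH]
    exact fun e he => hP (mem_image_of_mem _ he)
  rw [hE] at hqDF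
  have hqS : q ∈ ratFace H S := by
    rwa [← mobilePart_closure (isClosed_ratFace H S)]
  rintro _ ⟨e, he, rfl⟩
  have heS : e ∈ ratFace H S := by
    refine mem_ratFace.2 ⟨hPH he, fun h hh => le_antisymm (hPH he h (hSH hh)) ?_⟩
    obtain ⟨t, ht, hte⟩ := hint e he
    have h1 : form h ⬝ᵥ (q + t • (q - e)) ≤ h.2 := hPH hte h (hSH hh)
    rw [dotProduct_add, dotProduct_smul, dotProduct_sub, (mem_ratFace.1 hqS).2 h hh,
      smul_eq_mul] at h1
    -- The inequality holds at `e` and beyond `q` on the line from `e`, and is an equality at `q` in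
    -- between; so it is an equality at `e`.
    have h2 : t * (h.2 - form h ⬝ᵥ e) ≤ 0 := by linarith
    have := nonpos_of_mul_nonpos_right h2 ht
    linarith
  have : toTrop e ∈ ⋂₀ (({D, F} : Finset (Set (TropSpace N))) : Set (Set (TropSpace N))) := by
    rw [hE]
    exact subset_closure (mem_image_of_mem _ heS)
  exact this F (by simp)

/-- A point of a polyhedral complex can be moved a little along a wave tangent vector. -/
theorem PolyhedralComplex.eventually_translate_mem (Y : PolyhedralComplex N) {y : TropSpace N}
    (hy : y ∈ Y.support) {w : Fin N → ℝ} (hw : w ∈ Y.wave y) :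
    ∀ᶠ t : ℝ in 𝓝[>] 0, translate (t • w) y ∈ Y.support := by
  obtain ⟨D, hD, hyD⟩ := hy
  obtain ⟨H, -, hDH⟩ := Y.isDomain D hD
  obtain ⟨I, x, rfl⟩ := exists_stratumEmb_eq y
  rw [hDH] at hyD
  obtain ⟨S, q, r, hSH, hq, hev, hray, hqx, hrI, hrI', hx⟩ := exists_face_ray hyD
  have hPD : toTrop '' ratFace H S ⊆ D := by
    rw [hDH]
    exact (image_mono fun z hz => (mem_ratFace.1 hz).1).trans subset_closure
  have hdiff : ∀ e ∈ ratFace H S, e - q ∈ nullSpace S := fun e he h hh => by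
    rw [dotProduct_sub, (mem_ratFace.1 he).2 h hh, (mem_ratFace.1 hq).2 h hh, sub_self]
  have hnear : Y.IsNearbyMobile (stratumEmb I x) q := by
    refine ⟨_, ⟨D, hD, H, S, hSH, ⟨q, hq⟩, hDH, rfl⟩, ⟨I, x, rfl, hx⟩, ?_⟩
    rw [mobilePart_closure (isClosed_ratFace H S)]
    exact mem_intrinsicInterior_of_eventually hdiff hev
  have hwq : w ∈ Y.mobileWave q := by
    have h1 := (Submodule.mem_iInf _).1 hw q
    exact (Submodule.mem_iInf _).1 h1 hnear
  have hcone := Y.mobileWave_subset_tangentCone ⟨D, hD, hPD (mem_image_of_mem _ hq)⟩ hwq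
  have hint : ∀ e ∈ ratFace H S, ∃ t : ℝ, 0 < t ∧ q + t • (q - e) ∈ ratFace H S := by
    intro e he
    let v : nullSpace S := ⟨q - e, by rw [← neg_sub]; exact neg_mem (hdiff e he)⟩
    have hc : Tendsto (fun t : ℝ => t • v) (𝓝[>] 0) (𝓝 0) := by
      have : Continuous fun t : ℝ => t • v := continuous_id.smul continuous_const
      have := this.tendsto 0
      rw [zero_smul] at this
      exact this.mono_left nhdsWithin_le_nhds
    obtain ⟨t, ht, ht0⟩ := ((hc.eventually hev).and self_mem_nhdsWithin).exists
    exact ⟨t, ht0, ht⟩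
  -- one facet contains `q + t w` for arbitrarily small `t`
  have hfreq : ∃ F ∈ Y.facets, ∃ᶠ t : ℝ in 𝓝[>] 0, toTrop (q + t • w) ∈ F := by
    by_contra! hcon
    have h1 : ∀ᶠ t : ℝ in 𝓝[>] 0, ∀ F ∈ Y.facets, toTrop (q + t • w) ∉ F :=
      (Filter.eventually_all_finset _).2 fun F hF => hcon F hF
    obtain ⟨t, ⟨F, hF, htF⟩, ht⟩ :=
      ((show ∀ᶠ t : ℝ in 𝓝[>] 0, toTrop (q + t • w) ∈ Y.support from hcone).and h1).exists
    exact ht F hF htF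
  obtain ⟨F, hF, hfreq⟩ := hfreq
  obtain ⟨K, -, hFK⟩ := Y.isDomain F hF
  have hmob : ∀ z, toTrop z ∈ F ↔ z ∈ ratPolyhedron K := fun z => by
    conv_rhs => rw [← mobilePart_closure (isClosed_ratPolyhedron K), ← hFK]
    rfl
  -- `q` is a limit of points `q + t w` of the closed facet `F`. By `subset_facet` the facet then
  -- contains the face of `q` with its ray, which makes `r` a recession direction of `F`.
  have hqF : q ∈ ratPolyhedron K := by
    have hc : Continuous fun t : ℝ => q + t • w := by fun_prop
    have h1 : Tendsto (fun t : ℝ => q + t • w) (𝓝[>] 0) (𝓝 q) := by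
      simpa using (hc.tendsto 0).mono_left nhdsWithin_le_nhds
    refine (isClosed_ratPolyhedron K).mem_of_frequently_of_tendsto ?_ h1
    exact hfreq.mono fun t ht => (hmob _).1 ht
  have hsub := Y.subset_facet hD hF hPD ((hmob q).2 hqF) hq hint
  have hrK := dotProduct_nonpos_of_ray_subset (H := K) (q := q) (r := r) fun s hs =>
    (hmob _).1 (hsub (mem_image_of_mem _ (hray s hs)))
  obtain ⟨t₁, ht₁, ht₁0⟩ := (hfreq.and_eventually self_mem_nhdsWithin).exists
  rw [hmob] at ht₁
  -- By convexity a single `t₁` with `q + t₁ w` in `F` suffices for all smaller `t`.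
  filter_upwards [Ioo_mem_nhdsGT (show (0 : ℝ) < t₁ from ht₁0)] with t ht
  refine ⟨F, hF, ?_⟩
  have ht' : q + t • w ∈ ratPolyhedron K := by
    intro k hk
    have h0 : form k ⬝ᵥ q ≤ k.2 := hqF k hk
    have h1 : form k ⬝ᵥ (q + t₁ • w) ≤ k.2 := ht₁ k hk
    change form k ⬝ᵥ (q + t • w) ≤ k.2
    rw [dotProduct_add, dotProduct_smul, smul_eq_mul] at h1 ⊢
    rcases le_total (form k ⬝ᵥ w) 0 with hneg | hpos
    · linarith [mul_nonpos_of_nonneg_of_nonpos ht.1.le hneg]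
    · linarith [mul_le_mul_of_nonneg_right ht.2.le hpos]
  rw [translate_stratumEmb, hFK]
  refine stratumEmb_mem_closure (q := q + t • w) (fun i => ?_) hrI hrI' fun s hs k hk => ?_
  · rw [Pi.add_apply, hqx]
  · have h0 : form k ⬝ᵥ (q + t • w) ≤ k.2 := ht' k hk
    change form k ⬝ᵥ (q + t • w + s • r) ≤ k.2
    rw [dotProduct_add, dotProduct_smul, smul_eq_mul]
    linarith [mul_nonpos_of_nonneg_of_nonpos hs (hrK k hk)]

/-- If `w` is a wave tangent vector at all points of a complex near `y₀`, then all points near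
`y₀` can be moved along `w` by a uniform amount. -/
theorem PolyhedralComplex.eventually_forall_translate_mem (Y : PolyhedralComplex N)
    {y₀ : TropSpace N} {w : Fin N → ℝ} (hw : ∀ᶠ y in 𝓝 y₀, y ∈ Y.support → w ∈ Y.wave y) :
    ∃ G ∈ 𝓝 y₀, ∀ᶠ ε : ℝ in 𝓝[>] 0, ∀ y ∈ G, y ∈ Y.support → translate (ε • w) y ∈ Y.support := by
  have hcont : Continuous fun p : ℝ × TropSpace N => translate (p.1 • w) p.2 :=
    continuous_translate.comp ((continuous_fst.smul continuous_const).prodMk continuous_snd)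
  have h1 : ∀ᶠ p : ℝ × TropSpace N in 𝓝 (0, y₀), translate (p.1 • w) p.2 ∈ Y.support →
      w ∈ Y.wave (translate (p.1 • w) p.2) := by
    have := hcont.tendsto (0, y₀)
    rw [zero_smul, translate_zero] at this
    exact this.eventually hw
  rw [nhds_prod_eq] at h1
  obtain ⟨p, hp, G, hG, h2⟩ := eventually_prod_iff.1 h1
  obtain ⟨δ, hδ, hball⟩ := Metric.eventually_nhds_iff.1 hp
  refine ⟨{y | G y}, hG, ?_⟩
  filter_upwards [Ioo_mem_nhdsGT hδ] with ε hε y hyG hy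
  let s : Set ℝ := {t | translate (t • w) y ∈ Y.support}
  have hcy : Continuous fun t : ℝ => translate (t • w) y :=
    hcont.comp (continuous_id.prodMk continuous_const)
  have hs : IsClosed s := Y.isClosed_support.preimage hcy
  -- Continuous induction: the admissible times form a closed set containing 0, and each can be
  -- prolonged because `w` is still a wave vector at the point reached.
  have hsub : Icc 0 ε ⊆ s := by
    refine (hs.inter isClosed_Icc).Icc_subset_of_forall_mem_nhdsWithin ?_ ?_
    · change translate ((0 : ℝ) • w) y ∈ Y.support
      rwa [zero_smul, translate_zero]
    · rintro t ⟨hts, ht⟩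
      have hwt : w ∈ Y.wave (translate (t • w) y) :=
        h2 (hball (by rw [Real.dist_0_eq_abs, abs_of_nonneg ht.1]; exact ht.2.trans hε.2)) hyG hts
      have h3 := Y.eventually_translate_mem hts hwt
      have h4 : Tendsto (fun u : ℝ => u - t) (𝓝[>] t) (𝓝[>] 0) := by
        refine tendsto_nhdsWithin_iff.2 ⟨?_, ?_⟩
        · have : Continuous fun u : ℝ => u - t := by fun_prop
          simpa using (this.tendsto t).mono_left nhdsWithin_le_nhds
        · filter_upwards [self_mem_nhdsWithin] with u hu
          exact sub_pos.2 (mem_Ioi.1 hu)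
      filter_upwards [h4.eventually h3] with u hu
      rw [translate_translate, ← add_smul, add_sub_cancel] at hu
      exact hu
  exact hsub ⟨hε.1.le, le_rfl⟩

end Tropical

namespace Tropical

/-! ## Integral affine maps and translations -/

namespace IntAffine

variable {N M : ℕ}

theorem translate_eq_negInf_iff (v : Fin N → ℝ) (y : TropSpace N) (j : Fin N) :
    translate v y j = negInf ↔ y j = negInf := by
  rw [eq_negInf_iff, eq_negInf_iff]
  change (y j : EReal) + (v j : EReal) = ⊥ ↔ _
  rw [EReal.add_eq_bot_iff]
  simp

theorem definedAt_translate (h : IntAffine N M) (v : Fin N → ℝ) (y : TropSpace N) :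
    h.DefinedAt (translate v y) ↔ h.DefinedAt y := by
  simp only [DefinedAt, translate_eq_negInf_iff]

theorem eval_translate (h : IntAffine N M) (v : Fin N → ℝ) (y : TropSpace N) :
    h.eval (translate v y) = translate (h.differential v) (h.eval y) := by
  funext i
  apply Subtype.ext
  change _ = (h.eval y i : EReal) + (h.differential v i : EReal)
  simp only [eval, translate_eq_negInf_iff]
  split_ifs with hc
  · exact (EReal.bot_add _).symm
  · push Not at hc
    change ((_ : ℝ) : EReal) = ((_ : ℝ) : EReal) + _
    rw [← EReal.coe_add, EReal.coe_eq_coe_iff, differential, add_right_comm, add_left_inj,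
      ← Finset.sum_add_distrib]
    refine Finset.sum_congr rfl fun j _ => ?_
    -- An infinite coordinate enters with coefficient 0, so the default value of `toReal` there does
    -- not matter.
    by_cases hj : y j = negInf
    · simp [hc j hj]
    · rw [← mul_add]
      congr 1
      change ((y j : EReal) + (v j : EReal)).toReal = _
      rw [EReal.toReal_add (y j).2 (fun hb => hj (eq_negInf_iff.2 hb)) (EReal.coe_ne_top _)
        (EReal.coe_ne_bot _), EReal.toReal_coe]

theorem differential_smul (h : IntAffine N M) (c : ℝ) (v : Fin N → ℝ) :
    h.differential (c • v) = c • h.differential v := by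
  funext i
  simp only [differential, Pi.smul_apply, smul_eq_mul, Finset.mul_sum]
  exact Finset.sum_congr rfl fun j _ => by ring

/-- The composition of an integral affine map with a translation. -/
noncomputable def compTranslate (h : IntAffine N M) (v : Fin N → ℝ) : IntAffine N M where
  lin := h.lin
  const := h.const + h.differential v

theorem compTranslate_definedAt (h : IntAffine N M) (v : Fin N → ℝ) (y : TropSpace N) :
    (h.compTranslate v).DefinedAt y ↔ h.DefinedAt (translate v y) :=
  (h.definedAt_translate v y).symm

theorem compTranslate_eval (h : IntAffine N M) (v : Fin N → ℝ) (y : TropSpace N) :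
    (h.compTranslate v).eval y = h.eval (translate v y) := by
  rw [eval_translate]
  funext i
  apply Subtype.ext
  change _ = (h.eval y i : EReal) + (h.differential v i : EReal)
  unfold eval
  by_cases hc : ∃ j, y j = negInf ∧ h.lin i j ≠ 0
  · rw [if_pos (show ∃ j, y j = negInf ∧ (h.compTranslate v).lin i j ≠ 0 from hc), if_pos hc]
    exact (EReal.bot_add _).symm
  · rw [if_neg (show ¬∃ j, y j = negInf ∧ (h.compTranslate v).lin i j ≠ 0 from hc), if_neg hc]
    change ((_ + (_ + _) : ℝ) : EReal) = ((_ : ℝ) : EReal) + _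
    rw [← EReal.coe_add, add_assoc]
    rfl

end IntAffine

/-! ## Charts and sections as total functions -/

variable {X : Type u} [TopologicalSpace X] {ι : Type*} {N : ι → ℕ}
  {Y : ∀ i, PolyhedralComplex (N i)}

namespace TropicalAtlas

variable (T : TropicalAtlas X N Y)

open Classical in
/-- A chart, extended by an arbitrary value outside its domain. -/
noncomputable def chartFn (i : ι) (x : X) : TropSpace (N i) :=
  if h : x ∈ T.dom i then T.chart i ⟨x, h⟩ else fun _ => negInf

variable {T} {i j : ι} {x : X}

theorem chartFn_eq (h : x ∈ T.dom i) : T.chartFn i x = T.chart i ⟨x, h⟩ := dif_pos h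

theorem chartFn_mem (h : x ∈ T.dom i) : T.chartFn i x ∈ (Y i).support := by
  rw [chartFn_eq h]
  exact Subtype.prop _

theorem chartFn_inj {x' : X} (h : x ∈ T.dom i) (h' : x' ∈ T.dom i)
    (he : T.chartFn i x = T.chartFn i x') : x = x' := by
  rw [chartFn_eq h, chartFn_eq h'] at he
  exact congrArg Subtype.val ((T.isOpenEmbedding_chart i).injective (Subtype.ext he))

theorem continuousAt_chartFn (h : x ∈ T.dom i) : ContinuousAt (T.chartFn i) x := by
  rw [← (T.isOpen_dom i).isOpenEmbedding_subtypeVal.continuousAt_iff (x := ⟨x, h⟩)]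
  have : T.chartFn i ∘ (Subtype.val : T.dom i → X) = fun z => (T.chart i z : TropSpace (N i)) :=
    funext fun z => chartFn_eq z.2
  rw [this]
  exact (continuous_subtype_val.comp (T.isOpenEmbedding_chart i).continuous).continuousAt

/-- Openness of the chart, in the form in which it is used: support points near the image of `x`
come from points of `X` near `x`. -/
theorem exists_nhds_chartFn (h : x ∈ T.dom i) {O : Set X} (hO : O ∈ 𝓝 x) :
    ∃ G ∈ 𝓝 (T.chartFn i x), ∀ y ∈ G, y ∈ (Y i).support →
      ∃ z ∈ O, z ∈ T.dom i ∧ T.chartFn i z = y := by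
  have h1 : T.chart i '' (Subtype.val ⁻¹' O) ∈ 𝓝 (T.chart i ⟨x, h⟩) :=
    (T.isOpenEmbedding_chart i).isOpenMap.image_mem_nhds
      (continuous_subtype_val.continuousAt.preimage_mem_nhds hO)
  obtain ⟨G, hG, hsub⟩ := mem_nhds_subtype _ _ _ |>.1 h1
  refine ⟨G, by rwa [chartFn_eq h], fun y hy hyS => ?_⟩
  obtain ⟨z, hz, hzy⟩ := @hsub ⟨y, hyS⟩ hy
  exact ⟨z, hz, z.2, by rw [chartFn_eq z.2, hzy]⟩

theorem IsOverlapMap.eventually {h : IntAffine (N i) (N j)} (hh : T.IsOverlapMap i j x h)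
    (hi : x ∈ T.dom i) (hj : x ∈ T.dom j) :
    ∀ᶠ z in 𝓝 x, h.DefinedAt (T.chartFn i z) ∧ h.eval (T.chartFn i z) = T.chartFn j z := by
  filter_upwards [hh, (T.isOpen_dom i).mem_nhds hi, (T.isOpen_dom j).mem_nhds hj] with z hz hzi hzj
  rw [chartFn_eq hzi, chartFn_eq hzj]
  exact hz hzi hzj

end TropicalAtlas

namespace WaveSection

variable {T : TropicalAtlas X N Y} {O : Set X}

open Classical in
/-- The values of a section in a chart, extended by zero. -/
noncomputable def valFn (s : WaveSection T O) (i : ι) (x : X) : Fin (N i) → ℝ :=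
  if h : x ∈ O ∩ T.dom i then s.val i ⟨x, h⟩ else 0

variable {s : WaveSection T O} {i j : ι} {x : X}

theorem valFn_eq (hO : x ∈ O) (hi : x ∈ T.dom i) : s.valFn i x = s.val i ⟨x, hO, hi⟩ :=
  dif_pos (⟨hO, hi⟩ : x ∈ O ∩ T.dom i)

theorem valFn_mem_wave (hO : x ∈ O) (hi : x ∈ T.dom i) :
    s.valFn i x ∈ (Y i).wave (T.chartFn i x) := by
  rw [valFn_eq hO hi, T.chartFn_eq hi]
  exact s.mem_wave i ⟨x, hO, hi⟩

theorem eventually_valFn_eq (hOo : IsOpen O) (hO : x ∈ O) (hi : x ∈ T.dom i) :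
    ∀ᶠ z in 𝓝 x, s.valFn i z = s.valFn i x := by
  have hopen := hOo.inter (T.isOpen_dom i)
  have h1 := (s.locallyConstant i).eventually_eq ⟨x, hO, hi⟩
  have h2 := (hopen.isOpenEmbedding_subtypeVal.map_nhds_eq ⟨x, hO, hi⟩)
  change ∀ᶠ z in 𝓝 ((⟨x, hO, hi⟩ : ↥(O ∩ T.dom i)) : X), _
  rw [← h2, eventually_map]
  filter_upwards [h1] with z hz
  rw [valFn_eq z.2.1 z.2.2, valFn_eq hO hi]
  exact hz

theorem differential_valFn (hO : x ∈ O) (hi : x ∈ T.dom i) (hj : x ∈ T.dom j)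
    {h : IntAffine (N i) (N j)} (hh : T.IsOverlapMap i j x h) :
    h.differential (s.valFn i x) = s.valFn j x := by
  rw [valFn_eq hO hi, valFn_eq hO hj]
  exact s.differential_eq i j x hO hi hj h hh

end WaveSection

namespace WaveCocycle

variable {T : TropicalAtlas X N Y} {c : WaveCocycle T} {α β γ : c.A} {i : ι} {x : X}

theorem valFn_add (hα : x ∈ c.V α) (hβ : x ∈ c.V β) (hγ : x ∈ c.V γ) (hi : x ∈ T.dom i) :
    (c.sec α γ).valFn i x = (c.sec α β).valFn i x + (c.sec β γ).valFn i x := by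
  rw [WaveSection.valFn_eq (s := c.sec α γ) ⟨hα, hγ⟩ hi,
    WaveSection.valFn_eq (s := c.sec α β) ⟨hα, hβ⟩ hi,
    WaveSection.valFn_eq (s := c.sec β γ) ⟨hβ, hγ⟩ hi]
  exact c.cocycle α β γ i x hα hβ hγ hi

theorem valFn_self (hα : x ∈ c.V α) (hi : x ∈ T.dom i) : (c.sec α α).valFn i x = 0 := by
  simpa using c.valFn_add hα hα hα hi

theorem valFn_symm (hα : x ∈ c.V α) (hβ : x ∈ c.V β) (hi : x ∈ T.dom i) :
    (c.sec β α).valFn i x = -(c.sec α β).valFn i x := by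
  have := c.valFn_add hα hβ hα hi
  rw [c.valFn_self hα hi] at this
  exact (neg_eq_of_add_eq_zero_right this.symm).symm

end WaveCocycle

/-! ## The gluing relation near the diagonal -/

namespace DeformationData

variable {T : TropicalAtlas X N Y} {c : WaveCocycle T} (D : DeformationData c)

/-- The chart on `V α` as a total function. -/
noncomputable def f (α : c.A) : X → TropSpace (N (D.idx α)) := T.chartFn (D.idx α)

/-- The cocycle in the chart on `V α` as a total function. -/
noncomputable def t (α β : c.A) : X → Fin (N (D.idx α)) → ℝ := (c.sec α β).valFn (D.idx α)

/-- The gluing relation on points of `X`. -/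
def Glued (ε : ℝ) (α β : c.A) (x y : X) : Prop :=
  y ∈ c.V α ∧ y ∈ c.V β ∧ translate (ε • D.t α β y) (D.f α x) = D.f α y

variable {D} {α β γ : c.A} {p : X}

theorem phi_eq (x : X) (hx : x ∈ c.V α) : D.phi α x hx = D.f α x :=
  (T.chartFn_eq (D.subset_dom α hx)).symm

theorem tau_eq (x : X) (hx : x ∈ c.V α ∩ c.V β) : D.tau α β x hx = D.t α β x :=
  (WaveSection.valFn_eq hx (D.subset_dom α hx.1)).symm

theorem f_inj {x y : X} (hx : x ∈ c.V α) (hy : y ∈ c.V α) (h : D.f α x = D.f α y) : x = y :=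
  T.chartFn_inj (D.subset_dom α hx) (D.subset_dom α hy) h

/-- The chart on `V β` is injective, so the intermediate point `z` in the relation is `y` itself. -/
theorem rel_iff {ε : ℝ} {x : D.U α} {y : D.U β} :
    D.rel ε ⟨α, x⟩ ⟨β, y⟩ ↔ D.Glued ε α β x y := by
  constructor
  · rintro ⟨z, hz, h1, h2⟩
    simp only [phi_eq, tau_eq] at h1 h2
    obtain rfl : z = y := f_inj hz.2 (D.U_subset_V β y.2) h2
    exact ⟨hz.1, hz.2, h1⟩
  · rintro ⟨h1, h2, h3⟩
    refine ⟨y, ⟨h1, h2⟩, ?_, rfl⟩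
    have hy : (y : X) ∈ c.V α ∩ c.V β := ⟨h1, h2⟩
    change translate (ε • D.tau α β y hy) (D.phi α x _) = D.phi α y h1
    rw [phi_eq, phi_eq, tau_eq]
    exact h3

theorem continuousAt_f (hp : p ∈ c.V α) : ContinuousAt (D.f α) p :=
  T.continuousAt_chartFn (D.subset_dom α hp)

theorem eventually_t_eq (hα : p ∈ c.V α) (hβ : p ∈ c.V β) :
    ∀ᶠ z in 𝓝 p, z ∈ c.V α ∧ z ∈ c.V β ∧ D.t α β z = D.t α β p :=
  ((c.isOpen_V α).eventually_mem hα).and (((c.isOpen_V β).eventually_mem hβ).and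
    (WaveSection.eventually_valFn_eq ((c.isOpen_V α).inter (c.isOpen_V β)) ⟨hα, hβ⟩
      (D.subset_dom α hα)))

theorem exists_overlap (D : DeformationData c) (hα : p ∈ c.V α) (hβ : p ∈ c.V β) :
    ∃ h : IntAffine (N (D.idx α)) (N (D.idx β)),
      (∀ᶠ z in 𝓝 p, h.DefinedAt (D.f α z) ∧ h.eval (D.f α z) = D.f β z) ∧
      ∀ γ δ, p ∈ c.V γ → p ∈ c.V δ →
        h.differential ((c.sec γ δ).valFn (D.idx α) p) = (c.sec γ δ).valFn (D.idx β) p := by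
  have h1 := D.subset_dom α hα
  have h2 := D.subset_dom β hβ
  obtain ⟨h, hh⟩ := T.compatible (D.idx α) (D.idx β) p ⟨h1, h2⟩
  have hh' : T.IsOverlapMap _ _ p h := hh
  exact ⟨h, hh'.eventually h1 h2, fun γ δ hγ hδ =>
    WaveSection.differential_valFn (s := c.sec γ δ) ⟨hγ, hδ⟩ h1 h2 hh'⟩

/-- Near `p` the vectors are constant and the overlap map is affine. Applying it to the gluing
equation moves the equation to the chart of `β`, where the vector cancels against its negative. The
neighbourhood is independent of `ε`. -/
theorem Glued.symm_near (hα : p ∈ c.V α) (hβ : p ∈ c.V β) :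
    ∃ O ∈ 𝓝 p, ∀ x ∈ O, ∀ y ∈ O, ∀ ε, D.Glued ε α β x y → D.Glued ε β α y x := by
  obtain ⟨h, hh, hd⟩ := D.exists_overlap hα hβ
  refine ⟨_, (hh.and ((D.eventually_t_eq hα hβ).and (D.eventually_t_eq hβ hα))), ?_⟩
  rintro x ⟨⟨-, hx1⟩, ⟨hxα, hxβ, -⟩, -, -, hx2⟩ y ⟨⟨-, hy1⟩, ⟨-, -, hy2⟩, -⟩ ε ⟨-, -, he⟩
  refine ⟨hxβ, hxα, ?_⟩
  rw [hx2, ← hx1, ← hy1, ← he, hy2, IntAffine.eval_translate, translate_translate,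
    IntAffine.differential_smul, t, t, hd α β hα hβ, WaveCocycle.valFn_symm hα hβ (D.subset_dom β hβ),
    smul_neg, add_neg_cancel, translate_zero]

/-- The second gluing equation is carried into the chart of `α` by the overlap map; there the two
translations add up by the cocycle identity. -/
theorem Glued.trans_near (hα : p ∈ c.V α) (hβ : p ∈ c.V β) (hγ : p ∈ c.V γ) :
    ∃ O ∈ 𝓝 p, ∀ x ∈ O, ∀ y ∈ O, ∀ z ∈ O, ∀ ε, D.Glued ε α β x y → D.Glued ε β γ y z →
      D.Glued ε α γ x z := by
  obtain ⟨h, hh, hd⟩ := D.exists_overlap hβ hα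
  refine ⟨_, (hh.and ((D.eventually_t_eq hα hβ).and ((D.eventually_t_eq hβ hγ).and
    (D.eventually_t_eq hα hγ)))), ?_⟩
  rintro x - y ⟨⟨-, hy1⟩, ⟨-, -, hy2⟩, -⟩ z ⟨⟨-, hz1⟩, -, ⟨-, -, hz2⟩, hz3, hz4, hz5⟩ ε
    ⟨-, -, he⟩ ⟨-, -, he'⟩
  refine ⟨hz3, hz4, ?_⟩
  rw [← hz1, ← he', IntAffine.eval_translate, hy1, ← he, translate_translate, hz5, hy2, hz2,
    IntAffine.differential_smul, t, t, t, hd β γ hβ hγ,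
    WaveCocycle.valFn_add hα hβ hγ (D.subset_dom α hα), smul_add]

theorem exists_norm_t_le (D : DeformationData c) (α β : c.A) : ∃ M, ∀ z, ‖D.t α β z‖ ≤ M := by
  obtain ⟨M, hM⟩ := isBounded_iff_forall_norm_le.1 (D.bounded α β)
  refine ⟨max M 0, fun z => ?_⟩
  unfold t WaveSection.valFn
  split_ifs with h
  · exact (hM _ (mem_range_self _)).trans (le_max_left _ _)
  · rw [norm_zero]
    exact le_max_right _ _

theorem tendsto_translate_f {α : c.A} (hα : p ∈ c.V α) (v : Fin (N (D.idx α)) → ℝ) :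
    Tendsto (fun q : (Fin (N (D.idx α)) → ℝ) × X => translate q.1 (D.f α q.2))
      (𝓝 v ×ˢ 𝓝 p) (𝓝 (translate v (D.f α p))) := by
  have h1 := continuous_translate.tendsto (v, D.f α p)
  rw [nhds_prod_eq] at h1
  exact h1.comp (tendsto_id.prodMap (continuousAt_f hα))

/-- Glued points are close to each other if `ε` is small. -/
theorem Glued.near (D : DeformationData c) (β : c.A) (hα : p ∈ c.V α) {O : Set X} (hO : O ∈ 𝓝 p) :
    ∃ O' ∈ 𝓝 p, ∀ᶠ ε in 𝓝[>] (0 : ℝ), ∀ x ∈ O', ∀ y, D.Glued ε α β x y → y ∈ O := by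
  obtain ⟨M, hM⟩ := D.exists_norm_t_le α β
  obtain ⟨G, hG, hGO⟩ := T.exists_nhds_chartFn (D.subset_dom α hα) hO
  have h1 := D.tendsto_translate_f hα 0
  rw [translate_zero] at h1
  obtain ⟨P, hP, Q, hQ, hPQ⟩ := eventually_prod_iff.1 (h1.eventually hG)
  obtain ⟨δ, hδ, hball⟩ := Metric.eventually_nhds_iff.1 hP
  refine ⟨{x | Q x}, hQ, ?_⟩
  have hM0 : 0 ≤ M := (norm_nonneg _).trans (hM p)
  -- The denominator `M + 1` instead of `M` covers the case `M = 0`.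
  filter_upwards [Ioo_mem_nhdsGT (show 0 < δ / (M + 1) by positivity)] with ε hε x hx y hy
  have hlt : ‖ε • D.t α β y‖ < δ := by
    rw [norm_smul, Real.norm_of_nonneg hε.1.le]
    calc ε * ‖D.t α β y‖ ≤ ε * M := mul_le_mul_of_nonneg_left (hM y) hε.1.le
      _ < ε * (M + 1) := by linarith [mul_add ε M 1, hε.1]
      _ < δ := (lt_div_iff₀ (by positivity)).1 hε.2
  have h2 := hPQ (hball (by rwa [dist_zero_right])) hx
  simp only at h2
  rw [hy.2.2] at h2
  have hyd := D.subset_dom α hy.1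
  obtain ⟨z, hz, hzd, hzy⟩ := hGO _ h2 (T.chartFn_mem hyd)
  rwa [T.chartFn_inj hyd hzd hzy.symm]

/-- Points near `p` can be moved along the cocycle, uniformly in the point. -/
theorem eventually_translate_mem (D : DeformationData c) (hα : p ∈ c.V α) (hβ : p ∈ c.V β) :
    ∃ O ∈ 𝓝 p, ∀ᶠ ε in 𝓝[>] (0 : ℝ), ∀ x ∈ O,
      translate (ε • D.t α β p) (D.f α x) ∈ (Y (D.idx α)).support := by
  have hd := D.subset_dom α hα
  obtain ⟨G, hG, hGO⟩ := T.exists_nhds_chartFn hd (D.eventually_t_eq hα hβ)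
  -- Every support point near the image of `p` is the image of a point where the section has the
  -- same value as at `p`, so this one vector is a wave vector at all of them.
  have hw : ∀ᶠ y in 𝓝 (D.f α p), y ∈ (Y (D.idx α)).support → D.t α β p ∈ (Y (D.idx α)).wave y := by
    filter_upwards [hG] with y hy hyS
    obtain ⟨z, ⟨hzα, hzβ, hz⟩, hzd, rfl⟩ := hGO y hy hyS
    rw [← hz]
    exact WaveSection.valFn_mem_wave ⟨hzα, hzβ⟩ hzd
  obtain ⟨G', hG', hev⟩ := (Y (D.idx α)).eventually_forall_translate_mem hw
  refine ⟨D.f α ⁻¹' G' ∩ T.dom (D.idx α), inter_mem ((continuousAt_f hα).preimage_mem_nhds hG')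
    ((T.isOpen_dom _).mem_nhds hd), ?_⟩
  filter_upwards [hev] with ε hε x hx
  exact hε _ hx.1 (T.chartFn_mem hx.2)

end DeformationData

/-! ## Uniformly small parameters -/

/-- Finitely many of the neighbourhoods cover `K`, and finitely many eventual conditions on `ε` hold
together. This turns each local statement into a uniform one. -/
theorem eventually_forall_of_isCompact {K : Set X} (hK : IsCompact K) {l : Filter ℝ}
    {P : ℝ → X → Prop} (h : ∀ p ∈ K, ∃ O ∈ 𝓝 p, ∀ᶠ ε in l, ∀ x ∈ O, P ε x) :
    ∀ᶠ ε in l, ∀ x ∈ K, P ε x := by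
  refine hK.induction_on (p := fun S => ∀ᶠ ε in l, ∀ x ∈ S, P ε x) (by simp)
    (fun s t hst ht => ht.mono fun ε h x hx => h x (hst hx)) (fun s t hs ht => ?_) fun p hp => ?_
  · filter_upwards [hs, ht] with ε h1 h2 x hx using hx.elim (h1 x) (h2 x)
  · obtain ⟨O, hO, h1⟩ := h p hp
    exact ⟨O, mem_nhdsWithin_of_mem_nhds hO, h1⟩

namespace DeformationData

variable {T : TropicalAtlas X N Y} {c : WaveCocycle T} (D : DeformationData c)

/-- The conditions on `ε` under which the deformation is well behaved. -/
structure IsSmall (ε : ℝ) : Prop where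
  symm : ∀ α β, ∀ x ∈ D.U α, ∀ y ∈ D.U β, D.Glued ε α β x y → D.Glued ε β α y x
  trans : ∀ α β γ, ∀ x ∈ D.U α, ∀ y ∈ D.U β, ∀ z ∈ D.U γ, D.Glued ε α β x y → D.Glued ε β γ y z →
    D.Glued ε α γ x z
  closed : ∀ α β, ∃ C ⊆ c.V α, IsClosed C ∧ ∀ x ∈ D.U α, ∀ y ∈ D.U β, D.Glued ε α β x y → y ∈ C
  -- Here and in `hit` the point ranges over the closure, since the finite type condition produces
  -- limits on the boundary of `U α`.
  push : ∀ α β, ∀ x ∈ closure (D.U α), ∀ y ∈ D.U β, D.Glued ε α β x y →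
    ∀ᶠ x' in 𝓝 x, translate (ε • D.t α β y) (D.f α x') ∈ (Y (D.idx α)).support
  hit : ∀ α, ∀ x ∈ closure (D.U α), ∃ β, ∃ y ∈ D.U β, D.Glued ε α β x y

variable {D} {α β γ : c.A} {p : X}

/-- If `p` is outside the closure of `U β`, the complement of that closure is a neighbourhood of
`p`, so for small `ε` no point of `U β` is glued to a point near `p`. The local analysis at `p` thus
concerns only indices `β` with `p` in the closure. -/
theorem near_closure (hp : p ∈ closure (D.U α)) {O : Set X} (hO : p ∈ closure (D.U β) → O ∈ 𝓝 p) :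
    ∃ O' ∈ 𝓝 p, ∀ᶠ ε in 𝓝[>] (0 : ℝ), ∀ x ∈ O', ∀ y ∈ D.U β, D.Glued ε α β x y →
      p ∈ closure (D.U β) ∧ y ∈ O := by
  by_cases hpβ : p ∈ closure (D.U β)
  · obtain ⟨O', hO', h⟩ := Glued.near D β (D.closure_U α hp) (hO hpβ)
    exact ⟨O', hO', h.mono fun ε h x hx y _ hy => ⟨hpβ, h x hx y hy⟩⟩
  · obtain ⟨O', hO', h⟩ := Glued.near D β (D.closure_U α hp) (isClosed_closure.isOpen_compl.mem_nhds hpβ)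
    exact ⟨O', hO', h.mono fun ε h x hx y hyU hy => (h x hx y hy (subset_closure hyU)).elim⟩

variable (D)

/-! ### Each smallness condition holds for all small `ε`. -/

theorem eventually_symm [CompactSpace X] (α β : c.A) : ∀ᶠ ε in 𝓝[>] (0 : ℝ),
    ∀ x ∈ closure (D.U α), ∀ y ∈ D.U β, D.Glued ε α β x y → D.Glued ε β α y x := by
  refine eventually_forall_of_isCompact isClosed_closure.isCompact fun p hp => ?_
  by_cases hpβ : p ∈ c.V β
  · obtain ⟨O, hO, h⟩ := Glued.symm_near (D := D) (D.closure_U α hp) hpβ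
    obtain ⟨O', hO', h'⟩ := near_closure (D := D) (β := β) hp fun _ => hO
    refine ⟨O ∩ O', inter_mem hO hO', h'.mono fun ε h' x hx y hy hg => ?_⟩
    exact h x hx.1 y (h' x hx.2 y hy hg).2 ε hg
  · obtain ⟨O', hO', h'⟩ := near_closure (D := D) (β := β) hp (O := univ) fun _ => univ_mem
    exact ⟨O', hO', h'.mono fun ε h' x hx y hy hg =>
      (hpβ (D.closure_U β (h' x hx y hy hg).1)).elim⟩

theorem eventually_trans [CompactSpace X] (α β γ : c.A) : ∀ᶠ ε in 𝓝[>] (0 : ℝ),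
    ∀ x ∈ closure (D.U α), ∀ y ∈ D.U β, ∀ z ∈ D.U γ, D.Glued ε α β x y → D.Glued ε β γ y z →
      D.Glued ε α γ x z := by
  refine eventually_forall_of_isCompact isClosed_closure.isCompact fun p hp => ?_
  by_cases hpβ : p ∈ closure (D.U β)
  · have key : ∃ O ∈ 𝓝 p, p ∈ c.V γ → ∀ x ∈ O, ∀ y ∈ O, ∀ z ∈ O, ∀ ε, D.Glued ε α β x y →
        D.Glued ε β γ y z → D.Glued ε α γ x z := by
      by_cases hpγ : p ∈ c.V γ
      · obtain ⟨O, hO, h⟩ := Glued.trans_near (D := D) (D.closure_U α hp) (D.closure_U β hpβ) hpγ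
        exact ⟨O, hO, fun _ => h⟩
      · exact ⟨univ, univ_mem, fun h => (hpγ h).elim⟩
    obtain ⟨O, hO, h⟩ := key
    -- The neighbourhoods are chosen backwards: `O₁` controls the partners `z` of `y`, then `O₂`
    -- forces the partners `y` of `x` into `O ∩ O₁`.
    obtain ⟨O₁, hO₁, h₁⟩ := near_closure (D := D) (β := γ) hpβ fun _ => hO
    obtain ⟨O₂, hO₂, h₂⟩ := near_closure (D := D) (β := β) hp fun _ => inter_mem hO hO₁
    refine ⟨O ∩ O₂, inter_mem hO hO₂, ?_⟩
    filter_upwards [h₁, h₂] with ε h₁ h₂ x hx y hy z hz hxy hyz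
    obtain ⟨-, hyO, hyO₁⟩ := h₂ x hx.2 y hy hxy
    obtain ⟨hpγ, hzO⟩ := h₁ y hyO₁ z hz hyz
    exact h (D.closure_U γ hpγ) x hx.1 y hyO z hzO ε hxy hyz
  · obtain ⟨O', hO', h'⟩ := near_closure (D := D) (β := β) hp (O := univ) fun _ => univ_mem
    exact ⟨O', hO', h'.mono fun ε h' x hx y hy z _ hg => (hpβ (h' x hx y hy hg).1).elim⟩

/-- A set squeezed between the closure of `U α` and `V α` serves as `C`; it is fixed before `ε`. -/
theorem eventually_closed [CompactSpace X] [T2Space X] (α β : c.A) : ∃ C ⊆ c.V α, IsClosed C ∧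
    ∀ᶠ ε in 𝓝[>] (0 : ℝ), ∀ x ∈ closure (D.U α), ∀ y ∈ D.U β, D.Glued ε α β x y → y ∈ C := by
  obtain ⟨O, hO, hUO, hOV⟩ :=
    normal_exists_closure_subset isClosed_closure (c.isOpen_V α) (D.closure_U α)
  refine ⟨closure O, hOV, isClosed_closure, ?_⟩
  refine eventually_forall_of_isCompact isClosed_closure.isCompact fun p hp => ?_
  obtain ⟨O', hO', h'⟩ := near_closure (D := D) (β := β) hp fun _ => hO.mem_nhds (hUO hp)
  exact ⟨O', hO', h'.mono fun ε h' x hx y hy hg => subset_closure (h' x hx y hy hg).2⟩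

theorem eventually_push [CompactSpace X] (α β : c.A) : ∀ᶠ ε in 𝓝[>] (0 : ℝ),
    ∀ x ∈ closure (D.U α), ∀ y ∈ D.U β, D.Glued ε α β x y →
      ∀ᶠ x' in 𝓝 x, translate (ε • D.t α β y) (D.f α x') ∈ (Y (D.idx α)).support := by
  refine eventually_forall_of_isCompact isClosed_closure.isCompact fun p hp => ?_
  by_cases hpβ : p ∈ c.V β
  · have hpα := D.closure_U α hp
    obtain ⟨O, hO, h⟩ := D.eventually_translate_mem hpα hpβ
    obtain ⟨O', hO', h'⟩ := near_closure (D := D) (β := β) hp fun _ => D.eventually_t_eq hpα hpβ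
    refine ⟨interior O ∩ O', inter_mem (interior_mem_nhds.2 hO) hO', ?_⟩
    filter_upwards [h, h'] with ε h h' x hx y hy hg
    filter_upwards [isOpen_interior.mem_nhds hx.1] with x' hx'
    rw [(h' x hx.2 y hy hg).2.2.2]
    exact h x' (interior_subset hx')
  · obtain ⟨O', hO', h'⟩ := near_closure (D := D) (β := β) hp (O := univ) fun _ => univ_mem
    exact ⟨O', hO', h'.mono fun ε h' x hx y hy hg =>
      (hpβ (D.closure_U β (h' x hx y hy hg).1)).elim⟩

/-- For `β` with `p ∈ U β`, translating points near `p` by the vector at `p` keeps them in the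
support and close to the image of `p`, hence in the image of `U β`. -/
theorem eventually_hit [CompactSpace X] (α : c.A) : ∀ᶠ ε in 𝓝[>] (0 : ℝ),
    ∀ x ∈ closure (D.U α), ∃ β, ∃ y ∈ D.U β, D.Glued ε α β x y := by
  refine eventually_forall_of_isCompact isClosed_closure.isCompact fun p hp => ?_
  obtain ⟨β, hpβ⟩ := mem_iUnion.1 (D.cover_U.symm ▸ mem_univ p)
  have hpα := D.closure_U α hp
  have hpV := D.U_subset_V β hpβ
  obtain ⟨O, hO, h⟩ := D.eventually_translate_mem hpα hpV
  obtain ⟨G, hG, hGO⟩ := T.exists_nhds_chartFn (D.subset_dom α hpα)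
    (((D.isOpen_U β).eventually_mem hpβ).and (D.eventually_t_eq hpα hpV))
  have h1 : ∃ O' ∈ 𝓝 p, ∀ᶠ ε in 𝓝[>] (0 : ℝ), ∀ x ∈ O', translate (ε • D.t α β p) (D.f α x) ∈ G := by
    have h1 := D.tendsto_translate_f hpα 0
    rw [translate_zero] at h1
    obtain ⟨P, hP, Q, hQ, hPQ⟩ := eventually_prod_iff.1 (h1.eventually hG)
    refine ⟨{x | Q x}, hQ, ?_⟩
    have h2 : Tendsto (fun ε : ℝ => ε • D.t α β p) (𝓝[>] 0) (𝓝 0) := by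
      have : Continuous fun ε : ℝ => ε • D.t α β p := by fun_prop
      simpa using (this.tendsto 0).mono_left nhdsWithin_le_nhds
    filter_upwards [h2.eventually hP] with ε hε x hx using hPQ hε hx
  obtain ⟨O', hO', h'⟩ := h1
  refine ⟨O ∩ O', inter_mem hO hO', ?_⟩
  filter_upwards [h, h'] with ε h h' x hx
  obtain ⟨z, ⟨hzU, hzα, hzβ, hz⟩, hzd, hzx⟩ := hGO _ (h' x hx.2) (h x hx.1)
  exact ⟨β, z, hzU, hzα, hzβ, by rw [hz]; exact hzx.symm⟩

theorem eventually_isSmall [CompactSpace X] [T2Space X] : ∀ᶠ ε in 𝓝[>] (0 : ℝ), D.IsSmall ε := by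
  have := D.finite
  choose C hCV hC h3 using D.eventually_closed
  have h1 := eventually_all.2 fun α => eventually_all.2 fun β => D.eventually_symm α β
  have h2 := eventually_all.2 fun α => eventually_all.2 fun β => eventually_all.2 fun γ =>
    D.eventually_trans α β γ
  have h3 := eventually_all.2 fun α => eventually_all.2 fun β => h3 α β
  have h4 := eventually_all.2 fun α => eventually_all.2 fun β => D.eventually_push α β
  have h5 := eventually_all.2 fun α => D.eventually_hit α
  filter_upwards [h1, h2, h3, h4, h5] with ε h1 h2 h3 h4 h5
  exact ⟨fun α β x hx => h1 α β x (subset_closure hx),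
    fun α β γ x hx => h2 α β γ x (subset_closure hx),
    fun α β => ⟨C α β, hCV α β, hC α β, fun x hx => h3 α β x (subset_closure hx)⟩, h4, h5⟩

end DeformationData

end Tropical

namespace Tropical

variable {X : Type u} [TopologicalSpace X] {ι : Type*} {N : ι → ℕ}
  {Y : ∀ i, PolyhedralComplex (N i)}

/-! ## The deformed space -/

namespace DeformationData

variable {T : TropicalAtlas X N Y} {c : WaveCocycle T} {D : DeformationData c} {ε : ℝ}

theorem glued_refl {α : c.A} {x : X} (hx : x ∈ c.V α) : D.Glued ε α α x x :=
  ⟨hx, hx, by rw [t, WaveCocycle.valFn_self hx (D.subset_dom α hx), smul_zero, translate_zero]⟩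

theorem eq_of_glued_self {α : c.A} {x y : X} (hx : x ∈ c.V α) (h : D.Glued ε α α x y) : x = y := by
  obtain ⟨hy, -, he⟩ := h
  rw [t, WaveCocycle.valFn_self hy (D.subset_dom α hy), smul_zero, translate_zero] at he
  exact f_inj hx hy he

theorem IsSmall.equivalence (hε : D.IsSmall ε) : Equivalence (D.rel ε) where
  refl p := rel_iff.2 (glued_refl (D.U_subset_V _ p.2.2))
  symm {p q} h := rel_iff.2 (hε.symm _ _ _ p.2.2 _ q.2.2 (rel_iff.1 h))
  trans {p q r} h h' :=
    rel_iff.2 (hε.trans _ _ _ _ p.2.2 _ q.2.2 _ r.2.2 (rel_iff.1 h) (rel_iff.1 h'))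

theorem IsSmall.incl_eq_iff (hε : D.IsSmall ε) {α β : c.A} {x : D.U α} {y : D.U β} :
    D.incl ε α x = D.incl ε β y ↔ D.Glued ε α β x y := by
  rw [← rel_iff]
  exact hε.equivalence.quot_mk_eq_iff _ _

/-- By `push`, the vector that carries `x` to `y` carries nearby points into the support and near
`y`, so openness of the chart provides partners for them. -/
theorem IsSmall.eventually_exists_glued (hε : D.IsSmall ε) {α β : c.A} {x y : X}
    (hx : x ∈ closure (D.U α)) (hy : y ∈ D.U β) (h : D.Glued ε α β x y) {O : Set X} (hO : O ∈ 𝓝 y) :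
    ∀ᶠ x' in 𝓝 x, ∃ y' ∈ O, y' ∈ D.U β ∧ D.Glued ε α β x' y' := by
  obtain ⟨hyα, hyβ, he⟩ := id h
  obtain ⟨G, hG, hGO⟩ := T.exists_nhds_chartFn (D.subset_dom α hyα) (inter_mem hO
    (((D.isOpen_U β).eventually_mem hy).and (D.eventually_t_eq hyα hyβ)))
  have h1 : Tendsto (fun x' => translate (ε • D.t α β y) (D.f α x')) (𝓝 x) (𝓝 (D.f α y)) := by
    rw [← he]
    exact (D.tendsto_translate_f (D.closure_U α hx) _).comp (tendsto_const_nhds.prodMk tendsto_id)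
  filter_upwards [h1.eventually hG, hε.push α β x hx y hy h] with x' hx' hx'S
  obtain ⟨z, ⟨hzO, hzU, hzα, hzβ, hz⟩, -, hzx⟩ := hGO _ hx' hx'S
  exact ⟨z, hzO, hzU, hzα, hzβ, by rw [hz]; exact hzx.symm⟩

theorem continuous_incl (D : DeformationData c) (ε : ℝ) (α : c.A) : Continuous (D.incl ε α) :=
  continuous_quot_mk.comp continuous_sigmaMk

/-- The preimage in `U β` of the image of `O` consists of the points glued to some point of `O`; it
is open by `eventually_exists_glued`. -/
theorem IsSmall.isOpenMap_incl (hε : D.IsSmall ε) (α : c.A) : IsOpenMap (D.incl ε α) := by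
  intro O hO
  refine (isQuotientMap_quot_mk (r := D.rel ε)).isOpen_preimage.1 (isOpen_sigma_iff.2 ?_)
  intro β
  rw [isOpen_iff_mem_nhds]
  rintro y ⟨x, hxO, hxy⟩
  have hg : D.Glued ε β α y x := hε.incl_eq_iff.1 hxy.symm
  have hO' : Subtype.val '' O ∈ 𝓝 (x : X) :=
    ((D.isOpen_U α).isOpenMap_subtype_val O hO).mem_nhds (mem_image_of_mem _ hxO)
  have h1 := hε.eventually_exists_glued (subset_closure y.2) x.2 hg hO'
  filter_upwards [continuous_subtype_val.continuousAt.eventually h1] with y' hy'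
  obtain ⟨_, ⟨x', hx'O, rfl⟩, -, hg'⟩ := hy'
  exact ⟨x', hx'O, (hε.incl_eq_iff.2 hg').symm⟩

theorem IsSmall.isOpenEmbedding_incl (hε : D.IsSmall ε) (α : c.A) : IsOpenEmbedding (D.incl ε α) :=
  .of_continuous_injective_isOpenMap (D.continuous_incl ε α)
    (fun x _ h => Subtype.ext (eq_of_glued_self (D.U_subset_V α x.2) (hε.incl_eq_iff.1 h)))
    (hε.isOpenMap_incl α)

theorem exists_incl_eq (q : D.Space ε) : ∃ α x, D.incl ε α x = q := by
  obtain ⟨⟨α, x⟩, rfl⟩ := Quot.exists_rep q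
  exact ⟨α, x, rfl⟩

/-- The graph of the gluing relation is closed. If `y ∈ C ⊆ V α`, both sides of the gluing equation
are continuous near `(x, y)`, the vector being locally constant; if `y ∉ C`, points near `y` have no
partner in `U α` at all. With openness of the natural maps this yields the Hausdorff property. -/
theorem IsSmall.eventually_not_glued (hε : D.IsSmall ε) {α β : c.A} {x y : X}
    (hx : x ∈ D.U α) (hy : y ∈ D.U β) (h : ¬D.Glued ε α β x y) :
    ∀ᶠ q in 𝓝 x ×ˢ 𝓝 y, q.1 ∈ D.U α → q.2 ∈ D.U β → ¬D.Glued ε α β q.1 q.2 := by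
  obtain ⟨C, hCV, hC, hglued⟩ := hε.closed α β
  by_cases hyC : y ∈ C
  · have hyα := hCV hyC
    have hyβ := D.U_subset_V β hy
    have hne : translate (ε • D.t α β y) (D.f α x) ≠ D.f α y := fun he => h ⟨hyα, hyβ, he⟩
    have h1 : Tendsto (fun q : X × X => translate (ε • D.t α β y) (D.f α q.1)) (𝓝 x ×ˢ 𝓝 y)
        (𝓝 (translate (ε • D.t α β y) (D.f α x))) :=
      (D.tendsto_translate_f (D.U_subset_V α hx) _).comp (tendsto_const_nhds.prodMk tendsto_fst)
    have h2 : Tendsto (fun q : X × X => D.f α q.2) (𝓝 x ×ˢ 𝓝 y) (𝓝 (D.f α y)) :=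
      (continuousAt_f hyα).tendsto.comp tendsto_snd
    filter_upwards [(h1.prodMk_nhds h2).eventually (isClosed_diagonal.isOpen_compl.eventually_mem hne),
      tendsto_snd.eventually (D.eventually_t_eq hyα hyβ)]
      with q hq ht _ _ hg
    refine hq ?_
    rw [← ht.2.2]
    exact hg.2.2
  · filter_upwards [tendsto_snd.eventually (hC.isOpen_compl.eventually_mem hyC)] with q hq h1 h2 hg
    exact hq (hglued _ h1 _ h2 hg)

theorem IsSmall.t2Space (hε : D.IsSmall ε) : T2Space (D.Space ε) := by
  rw [t2Space_iff_disjoint_nhds]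
  intro p q hpq
  obtain ⟨α, x, rfl⟩ := exists_incl_eq p
  obtain ⟨β, y, rfl⟩ := exists_incl_eq q
  obtain ⟨P, hP, Q, hQ, hPQ⟩ := eventually_prod_iff.1
    (hε.eventually_not_glued x.2 y.2 fun h => hpq (hε.incl_eq_iff.2 h))
  refine Filter.disjoint_iff.2
    ⟨_, (hε.isOpenMap_incl α).image_mem_nhds (continuous_subtype_val.continuousAt.eventually hP),
      _, (hε.isOpenMap_incl β).image_mem_nhds (continuous_subtype_val.continuousAt.eventually hQ), ?_⟩
  rw [Set.disjoint_left]
  rintro _ ⟨x', hx', rfl⟩ ⟨y', hy', he⟩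
  exact hPQ hx' hy' x'.2 y'.2 (hε.incl_eq_iff.1 he.symm)

/-- The chart `φ_α` restricted to `U α`. -/
noncomputable def chartU (D : DeformationData c) (α : c.A) : D.U α → (Y (D.idx α)).support :=
  fun x => T.chart (D.idx α) ⟨x, D.subset_dom α (D.U_subset_V α x.2)⟩

theorem isOpenEmbedding_chartU (D : DeformationData c) (α : c.A) :
    IsOpenEmbedding (D.chartU α) := by
  have hsub : D.U α ⊆ T.dom (D.idx α) := fun x hx => D.subset_dom α (D.U_subset_V α hx)
  have h : IsOpenEmbedding (Set.inclusion hsub) :=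
    ⟨.inclusion hsub, by
      rw [Set.range_inclusion]
      exact (D.isOpen_U α).preimage continuous_subtype_val⟩
  exact (T.isOpenEmbedding_chart (D.idx α)).comp h

/-- The chart of the deformed space on the image of `U α`. -/
noncomputable def IsSmall.chart (hε : D.IsSmall ε) (α : c.A) :
    range (D.incl ε α) → (Y (D.idx α)).support :=
  D.chartU α ∘ (hε.isOpenEmbedding_incl α).isEmbedding.toHomeomorph.symm

theorem IsSmall.chart_incl (hε : D.IsSmall ε) {α : c.A} {p : D.Space ε}
    (hp : p ∈ range (D.incl ε α)) {x : D.U α} (hx : D.incl ε α x = p) :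
    (hε.chart α ⟨p, hp⟩ : TropSpace (N (D.idx α))) = D.f α x := by
  subst hx
  have : (hε.isOpenEmbedding_incl α).isEmbedding.toHomeomorph.symm ⟨D.incl ε α x, hp⟩ = x :=
    (hε.isOpenEmbedding_incl α).isEmbedding.toHomeomorph.symm_apply_apply x
  rw [IsSmall.chart, Function.comp_apply, this]
  exact (T.chartFn_eq _).symm

/-- The deformed tropical space. -/
noncomputable def IsSmall.atlas [CompactSpace X] (hε : D.IsSmall ε) :
    TropicalAtlas (D.Space ε) (fun α => N (D.idx α)) (fun α => Y (D.idx α)) where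
  balanced α := T.balanced _
  regular α := T.regular _
  dom α := range (D.incl ε α)
  chart := hε.chart
  isOpen_dom α := (hε.isOpenEmbedding_incl α).isOpen_range
  cover := by
    refine eq_univ_of_forall fun p => ?_
    obtain ⟨α, x, rfl⟩ := exists_incl_eq p
    exact mem_iUnion.2 ⟨α, mem_range_self x⟩
  isOpenEmbedding_chart α := (D.isOpenEmbedding_chartU α).comp
    (hε.isOpenEmbedding_incl α).isEmbedding.toHomeomorph.symm.isOpenEmbedding
  compatible := by
    rintro α β p ⟨⟨x, hx⟩, ⟨y, rfl⟩⟩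
    obtain ⟨hyα, hyβ, -⟩ := hε.incl_eq_iff.1 hx
    obtain ⟨h, hh, -⟩ := D.exists_overlap hyα hyβ
    -- The new overlap map is the old one after translation by `ε τ_{αβ}`, a constant vector near
    -- `y`.
    refine ⟨h.compTranslate (ε • D.t α β y), ?_⟩
    have h1 := continuous_subtype_val.continuousAt.eventually
      (hh.and (D.eventually_t_eq hyα hyβ) : ∀ᶠ z in 𝓝 (y : X), _)
    filter_upwards [(hε.isOpenMap_incl β).image_mem_nhds h1]
    rintro _ ⟨y', ⟨⟨hdef, heval⟩, -, -, ht⟩, rfl⟩ hi hj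
    obtain ⟨x', hx'⟩ := id hi
    obtain ⟨-, -, he⟩ := hε.incl_eq_iff.1 hx'
    rw [hε.chart_incl hi hx', hε.chart_incl hj rfl, IntAffine.compTranslate_definedAt,
      IntAffine.compTranslate_eval, ← ht, he]
    exact ⟨hdef, heval⟩
  finite_charts := D.finite
  finite_type := by
    intro α s y hs
    choose x hx using fun n => (s n).2
    have hxs : ∀ n, (hε.chart α (s n) : TropSpace (N (D.idx α))) = D.f α (x n) := fun n =>
      hε.chart_incl (s n).2 (hx n)
    have hd : ∀ z : D.U α, (z : X) ∈ T.dom (D.idx α) := fun z =>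
      D.subset_dom α (D.U_subset_V α z.2)
    have hf : ∀ z : D.U α, (T.chart (D.idx α) ⟨z, hd z⟩ : TropSpace (N (D.idx α))) = D.f α z :=
      fun z => (T.chartFn_eq (hd z)).symm
    rcases T.finite_type (D.idx α) (fun n => ⟨x n, hd (x n)⟩) y (by simpa only [hf, hxs] using hs)
      with ⟨x₀, hx₀⟩ | ⟨k, hk, hfin⟩
    · left
      have hcl : x₀ ∈ closure (D.U α) :=
        mem_closure_of_tendsto hx₀ (Eventually.of_forall fun n => (x n).2)
      -- The limit `x₀` may lie outside `U α`, but it is glued to a point `y₀` of some `U β`, and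
      -- the sequence converges to the class of `y₀`.
      obtain ⟨β, y₀, hy₀, hg⟩ := hε.hit α x₀ hcl
      refine ⟨D.incl ε β ⟨y₀, hy₀⟩, tendsto_def.2 fun W hW => ?_⟩
      have hO : Subtype.val '' (D.incl ε β ⁻¹' W) ∈ 𝓝 y₀ :=
        (D.isOpen_U β).isOpenMap_subtype_val.image_mem_nhds
          ((D.continuous_incl ε β).continuousAt.preimage_mem_nhds hW)
      filter_upwards [hx₀.eventually (hε.eventually_exists_glued hcl hy₀ hg hO)] with n hn
      obtain ⟨_, ⟨y', hy', rfl⟩, -, hg'⟩ := hn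
      have : (s n : D.Space ε) = D.incl ε β y' := (hx n).symm.trans (hε.incl_eq_iff.2 hg')
      rw [mem_preimage, this]
      exact hy'
    · right
      refine ⟨k, hk, ?_⟩
      rintro ⟨p, hp⟩
      obtain ⟨z, hz⟩ := id hp
      rw [hε.chart_incl hp hz, ← hf]
      exact hfin _

end DeformationData

/-! ## Representing a class by a bounded cocycle -/

namespace WaveSection

variable {T : TropicalAtlas X N Y}

/-- The restriction of a section. -/
def restrict {O O' : Set X} (s : WaveSection T O) (h : O' ⊆ O) : WaveSection T O' where
  val i x := s.val i ⟨x, h x.2.1, x.2.2⟩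
  mem_wave i x := s.mem_wave i ⟨x, h x.2.1, x.2.2⟩
  locallyConstant i := (s.locallyConstant i).comp_continuous
    (f := fun x : ↥(O' ∩ T.dom i) => (⟨x, h x.2.1, x.2.2⟩ : ↥(O ∩ T.dom i)))
    (continuous_subtype_val.subtype_mk _)
  differential_eq i j x hO hi hj g hg := s.differential_eq i j x (h hO) hi hj g hg

/-- The zero section. -/
def zero (T : TropicalAtlas X N Y) (O : Set X) : WaveSection T O where
  val i x := 0
  mem_wave i x := zero_mem _
  locallyConstant i := IsLocallyConstant.const 0
  differential_eq i j x hO hi hj g hg := by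
    funext k
    simp [IntAffine.differential]

end WaveSection

namespace WaveCocycle

variable {T : TropicalAtlas X N Y}

/-- The restriction of a cocycle to a refinement of its cover. -/
def refine (c : WaveCocycle T) {B : Type u} (W : B → Set X) (hW : ∀ b, IsOpen (W b))
    (hcov : ⋃ b, W b = univ) (r : B → c.A) (hr : ∀ b, W b ⊆ c.V (r b)) : WaveCocycle T where
  A := B
  V := W
  isOpen_V := hW
  cover := hcov
  sec a b := (c.sec (r a) (r b)).restrict (inter_subset_inter (hr a) (hr b))
  cocycle a b d i x ha hb hd hi := c.cocycle (r a) (r b) (r d) i x (hr a ha) (hr b hb) (hr d hd) hi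

theorem refine_toH1 (c : WaveCocycle T) {B : Type u} (W : B → Set X) (hW : ∀ b, IsOpen (W b))
    (hcov : ⋃ b, W b = univ) (r : B → c.A) (hr : ∀ b, W b ⊆ c.V (r b)) :
    (c.refine W hW hcov r hr).toH1 = c.toH1 :=
  Quot.sound ⟨B, W, id, r, fun k => WaveSection.zero T (W k), fun k => subset_rfl, hr, hW, hcov,
    fun k l i x hk hl hi => by
      change (c.sec (r k) (r l)).val i ⟨x, _⟩ - (c.sec (r k) (r l)).val i ⟨x, _⟩ = 0 - 0
      rw [sub_self, sub_self]⟩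

theorem exists_deformationData [CompactSpace X] [T2Space X] (c : WaveCocycle T) :
    ∃ c' : WaveCocycle T, c'.toH1 = c.toH1 ∧ Nonempty (DeformationData c') := by
  have h1 : ∀ p : X, ∃ α, p ∈ c.V α := fun p => mem_iUnion.1 (c.cover.symm ▸ mem_univ p)
  have h2 : ∀ p : X, ∃ i, p ∈ T.dom i := fun p => mem_iUnion.1 (T.cover.symm ▸ mem_univ p)
  choose r hr using h1
  choose k hk using h2
  obtain ⟨F, hF⟩ := isCompact_univ.elim_finite_subcover (fun p => c.V (r p) ∩ T.dom (k p))
    (fun p => (c.isOpen_V _).inter (T.isOpen_dom _)) fun p _ => mem_iUnion.2 ⟨p, hr p, hk p⟩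
  let B : Type u := {p // p ∈ F}
  let O : B → Set X := fun p => c.V (r p) ∩ T.dom (k p)
  have hO : ∀ b, IsOpen (O b) := fun b => (c.isOpen_V _).inter (T.isOpen_dom _)
  have hOcov : ⋃ b, O b = univ := by
    refine univ_subset_iff.1 (hF.trans (iUnion₂_subset fun p hp => ?_))
    exact subset_iUnion O ⟨p, hp⟩
  -- Two shrinkings: the cover `W` carries the new cocycle, with closures in the old domains to give
  -- boundedness, and `U` is the smaller cover to be glued.
  obtain ⟨W, hWcov, hW, hWO⟩ := exists_iUnion_eq_closure_subset hO (fun _ => toFinite _) hOcov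
  obtain ⟨U, hUcov, hU, hUW⟩ := exists_iUnion_eq_closure_subset hW (fun _ => toFinite _) hWcov
  have hWV : ∀ b, W b ⊆ c.V (r b) := fun b => subset_closure.trans ((hWO b).trans inter_subset_left)
  refine ⟨c.refine W hW hWcov (fun b => r b) hWV, c.refine_toH1 _ _ _ _ _, ⟨?_⟩⟩
  refine ⟨inferInstanceAs (Finite B), fun b : B => k b,
    fun b : B => subset_closure.trans ((hWO b).trans inter_subset_right), U, hU, hUcov, hUW, ?_⟩
  intro (a : B) (b : B)
  -- On this compact set the section of the original cocycle is continuous, hence bounded, and the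
  -- set contains all points of `W a ∩ W b`.
  let S : Set ↥((c.V (r a) ∩ c.V (r b)) ∩ T.dom (k a)) :=
    Subtype.val ⁻¹' (closure (W a) ∩ closure (W b))
  have hS : IsCompact S := by
    refine Topology.IsInducing.subtypeVal.isCompact_preimage_iff ?_ |>.2
      (isClosed_closure.inter isClosed_closure).isCompact
    rw [Subtype.range_coe]
    exact fun x hx => ⟨⟨(hWO a hx.1).1, (hWO b hx.2).1⟩, (hWO a hx.1).2⟩
  refine ((hS.image ((c.sec (r a) (r b)).locallyConstant (k a)).continuous).isBounded).subset ?_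
  rintro _ ⟨x, rfl⟩
  exact ⟨⟨x, ⟨hWV a x.2.1.1, hWV b x.2.1.2⟩, x.2.2⟩, ⟨subset_closure x.2.1.1, subset_closure x.2.1.2⟩, rfl⟩

end WaveCocycle

end Tropical

/-! ### The proposition. -/

theorem mainTheorem12 {X : Type u} [TopologicalSpace X] [CompactSpace X] [T2Space X]
    {ι : Type*} {N : ι → ℕ} {Y : ∀ i, Tropical.PolyhedralComplex (N i)}
    (T : Tropical.TropicalAtlas X N Y) (τ : Tropical.WaveH1 T) :
    (∃ c : Tropical.WaveCocycle T, c.toH1 = τ ∧ Nonempty (Tropical.DeformationData c)) ∧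
    ∀ (c : Tropical.WaveCocycle T), c.toH1 = τ → ∀ D : Tropical.DeformationData c,
      ∃ ε₀ : ℝ, 0 < ε₀ ∧ ∀ ε : ℝ, 0 < ε → ε < ε₀ →
        Equivalence (D.rel ε) ∧
        T2Space (D.Space ε) ∧
        (∀ α, IsOpenEmbedding (D.incl ε α)) ∧
        ∃ T' : Tropical.TropicalAtlas (D.Space ε) (fun α => N (D.idx α)) (fun α => Y (D.idx α)),
          ∀ α, T'.dom α = range (D.incl ε α) ∧
            ∀ (x : D.U α) (hx : D.incl ε α x ∈ T'.dom α),
              (T'.chart α ⟨D.incl ε α x, hx⟩ : Tropical.TropSpace (N (D.idx α))) =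
                D.phi α x (D.U_subset_V α x.2) := by
  refine ⟨?_, fun c _ D => ?_⟩
  · obtain ⟨c, rfl⟩ := Quot.exists_rep τ
    exact c.exists_deformationData
  · obtain ⟨ε₀, hε₀, hsub⟩ := mem_nhdsGT_iff_exists_Ioo_subset.1 D.eventually_isSmall
    refine ⟨ε₀, hε₀, fun ε h0 h1 => ?_⟩
    have hε : D.IsSmall ε := hsub ⟨h0, h1⟩
    refine ⟨hε.equivalence, hε.t2Space, hε.isOpenEmbedding_incl, hε.atlas, fun α => ⟨rfl, ?_⟩⟩
    intro x hx
    rw [Tropical.DeformationData.phi_eq]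
    exact hε.chart_incl hx rfl
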